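/- Let $L, M, J > 0$, let $\mu, \Lambda \in C^4[0,L]$ be strictly positive, and let $n \in \mathbb{N}_0$. For $j = 1,2$ let $A_j \in \mathbb{R}^{n\times n}$ be a Hurwitz matrix (all its eigenvalues have negative real part), let $b_j, c_j \in \mathbb{R}^n$, $k_j > 0$ and $d_j \in \mathbb{R}$, and assume that the transfer functions $\mathcal{G}_j(s) = (sI - A_j)^{-1} b_j \cdot c_j + d_j$ satisfy $\operatorname{Re} \mathcal{G}_j(i\omega) \ge d_j \ge \delta_j > 0$ for all $\omega \ge 0$ with some constant $\delta_j$. Let $H = \mathbb{R}\times\mathbb{R}\times L^2(0,L)$ with the inner product $$(\hat\varphi,\hat\nu)_H = J\,{}^1\hat\varphi\,{}^1\hat\nu + M\,{}^2\hat\varphi\,{}^2\hat\nu + (\mu\,{}^3\hat\varphi, {}^3\hat\nu)_{L^2},$$ and let $V = \{\hat w = (w_x(L), w(L), w) : w \in H^2(0,L),\ w(0) = w_x(0) = 0\} \subset H$ with the inner product $(\hat w_1, \hat w_2)_V = (\Lambda (w_1)_{xx}, (w_2)_{xx})_{L^2}$. Let $V'$ be the dual space of $V$, where $\hat\varphi \in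 H$ is identified with the functional $(\hat\varphi, \cdot)_H \in V'$. Put $$a(\hat v,\hat w) = (\hat v,\hat w)_V + k_1 v_x(L) w_x(L) + k_2 v(L) w(L), \qquad b(\hat\varphi,\hat\nu) = d_1\,{}^1\hat\varphi\,{}^1\hat\nu + d_2\,{}^2\hat\varphi\,{}^2\hat\nu,$$ $$e_1(\zeta,\hat w) = (c_1\cdot\zeta)\, w_x(L), \qquad e_2(\zeta,\hat w) = (c_2\cdot\zeta)\, w(L).$$ Let $T > 0$, $\hat u_0 \in V$, $\hat v_0 \in H$ and $\zeta_{1,0}, \zeta_{2,0} \in \mathbb{R}^n$. A triple $(\hat u, \zeta_1, \zeta_2)$ is called a weak solution if $$\hat u \in L^2(0,T;V)\cap H^1(0,T;H)\cap H^2(0,T;V'), \qquad \zeta_1,\zeta_2 \in H^1(0,T;\mathbb{R}^n),$$ if for a.e. $t \in (0,T)$ $${}_{V'}\langle \hat u_{tt}, \hat w\rangle_V + a(\hat u,\hat w) + b(\hat u_t,\hat w) + e_1(\zeta_1,\hat w) + e_2(\zeta_2,\hat w) = 0 \qquad \text{for all } \hat w \in V,$$ $$(\zeta_1)_t = A_1\zeta_1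 + b_1\,({}^1\hat u_t), \qquad (\zeta_2)_t = A_2\zeta_2 + b_2\,({}^2\hat u_t),$$ and if $\hat u(0) = \hat u_0$, $\hat u_t(0) = \hat v_0$, $\zeta_1(0) = \zeta_{1,0}$, $\zeta_2(0) = \zeta_{2,0}$. Here the initial values are those of the continuous representatives $\hat u \in C([0,T];H)$, $\hat u_t \in C([0,T];V')$, $\zeta_j \in C([0,T];\mathbb{R}^n)$. Then every weak solution satisfies, after modification on a set of times of measure zero, $$\hat u \in C([0,T];V) \qquad\text{and}\qquad \hat u_t \in C([0,T];H).$$ -/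

import Mathlib

open MeasureTheory Set Matrix
open scoped ContDiff RealInnerProductSpace

namespace PiezoBeam

/-! ### Distributional derivatives on an interval -/

/-- `φ ∈ C_c^∞(a, b)`. -/
structure IsTestFun (a b : ℝ) (φ : ℝ → ℝ) : Prop where
  smooth : ContDiff ℝ ∞ φ
  compact : HasCompactSupport φ
  supp : tsupport φ ⊆ Ioo a b

/-- `g` is the weak (distributional) derivative of the real function `f` on `(a, b)`. It is only
used for functions which are integrable on `(a, b)`. -/
def HasWeakDerivOn (a b : ℝ) (f g : ℝ → ℝ) : Prop :=
  ∀ φ : ℝ → ℝ, IsTestFun a b φ →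
    ∫ x in Ioo a b, f x * deriv φ x = -∫ x in Ioo a b, g x * φ x

/-- The trace at `x ∈ [0, L]` of `f` is `r`: the function `f` agrees a.e. on `(0, L)` with a
function which is continuous on `[0, L]` and has the value `r` at `x`. -/
def HasTrace (L : ℝ) (f : ℝ → ℝ) (x r : ℝ) : Prop :=
  ∃ F : ℝ → ℝ, ContinuousOn F (Icc 0 L) ∧ f =ᵐ[volume.restrict (Ioo 0 L)] F ∧ F x = r

/-- The space `L²(0, L)`. -/
abbrev L2 (L : ℝ) : Type := Lp ℝ 2 (volume.restrict (Ioo (0 : ℝ) L))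

/-! ### The data of the model -/

/-- The beam with its tip body: length `L`, mass `M` and moment of inertia `J` of the tip body,
linear mass density `μ` and flexural rigidity `Λ`. -/
structure Beam where
  L : ℝ
  M : ℝ
  J : ℝ
  μ : ℝ → ℝ
  Λ : ℝ → ℝ
  L_pos : 0 < L
  M_pos : 0 < M
  J_pos : 0 < J
  μ_smooth : ContDiffOn ℝ 4 μ (Icc 0 L)
  Λ_smooth : ContDiffOn ℝ 4 Λ (Icc 0 L)
  μ_pos : ∀ x ∈ Icc 0 L, 0 < μ x
  Λ_pos : ∀ x ∈ Icc 0 L, 0 < Λ x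

/-- The transfer function `𝒢(s) = (s I - A)⁻¹ b · c + d`. -/
noncomputable def transferFunction {n : ℕ} (A : Matrix (Fin n) (Fin n) ℝ) (b c : Fin n → ℝ)
    (d : ℝ) (s : ℂ) : ℂ :=
  ((s • (1 : Matrix (Fin n) (Fin n) ℂ) - A.map Complex.ofReal)⁻¹ *ᵥ (fun i => (b i : ℂ))) ⬝ᵥ
    (fun i => (c i : ℂ)) + d

/-- One of the two dynamic controllers, with the internal state `ζ ∈ ℝⁿ`. -/
structure Controller (n : ℕ) where
  A : Matrix (Fin n) (Fin n) ℝ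
  b : Fin n → ℝ
  c : Fin n → ℝ
  k : ℝ
  d : ℝ
  hurwitz : ∀ z ∈ spectrum ℂ (A.map Complex.ofReal), z.re < 0
  k_pos : 0 < k
  transfer : ∃ δ : ℝ, 0 < δ ∧ δ ≤ d ∧
    ∀ y : ℝ, 0 ≤ y → d ≤ (transferFunction A b c d (Complex.I * y)).re

/-! ### Auxiliary facts, needed for the inner products -/

theorem L2.integrable_weight {L : ℝ} {ρ : ℝ → ℝ} (hρ : ContinuousOn ρ (Icc 0 L)) (f g : L2 L) :
    Integrable (fun x => ρ x * (f x * g x)) (volume.restrict (Ioo 0 L)) := by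
  have h : Integrable (fun x => f x * g x) (volume.restrict (Ioo (0 : ℝ) L)) := by
    have := MeasureTheory.L2.integrable_inner (𝕜 := ℝ) g f
    simpa [mul_comm] using this
  obtain ⟨C, hC⟩ := isCompact_Icc.exists_bound_of_continuousOn hρ
  refine h.bdd_mul (c := C) ?_ ?_
  · exact (hρ.mono Ioo_subset_Icc_self).aestronglyMeasurable measurableSet_Ioo
  · filter_upwards [ae_restrict_mem measurableSet_Ioo] with x hx
    exact hC x (Ioo_subset_Icc_self hx)

/-- The weighted `L²` product `∫₀ᴸ ρ f g dx`. -/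
noncomputable def weighted {L : ℝ} (ρ : ℝ → ℝ) (f g : L2 L) : ℝ :=
  ∫ x in Ioo 0 L, ρ x * (f x * g x)

theorem weighted_comm {L : ℝ} (ρ : ℝ → ℝ) (f g : L2 L) : weighted ρ f g = weighted ρ g f := by
  simp only [weighted, mul_comm (f _)]

theorem weighted_add {L : ℝ} {ρ : ℝ → ℝ} (hρ : ContinuousOn ρ (Icc 0 L)) (f f' g : L2 L) :
    weighted ρ (f + f') g = weighted ρ f g + weighted ρ f' g := by
  unfold weighted
  rw [← integral_add (L2.integrable_weight hρ f g) (L2.integrable_weight hρ f' g)]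
  refine integral_congr_ae ?_
  filter_upwards [Lp.coeFn_add f f'] with x hx
  rw [hx, Pi.add_apply]; ring

theorem weighted_smul {L : ℝ} (ρ : ℝ → ℝ) (r : ℝ) (f g : L2 L) :
    weighted ρ (r • f) g = r * weighted ρ f g := by
  unfold weighted
  rw [← integral_const_mul]
  refine integral_congr_ae ?_
  filter_upwards [Lp.coeFn_smul r f] with x hx
  rw [hx, Pi.smul_apply, smul_eq_mul]; ring

theorem weighted_nonneg {L : ℝ} {ρ : ℝ → ℝ} (hp : ∀ x ∈ Icc 0 L, 0 < ρ x) (f : L2 L) :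
    0 ≤ weighted ρ f f :=
  setIntegral_nonneg measurableSet_Ioo fun x hx =>
    mul_nonneg (hp x (Ioo_subset_Icc_self hx)).le (mul_self_nonneg _)

theorem weighted_definite {L : ℝ} {ρ : ℝ → ℝ} (hρ : ContinuousOn ρ (Icc 0 L))
    (hp : ∀ x ∈ Icc 0 L, 0 < ρ x) (f : L2 L) (h : weighted ρ f f = 0) : f = 0 := by
  have h0 : 0 ≤ᵐ[volume.restrict (Ioo (0 : ℝ) L)] fun x => ρ x * (f x * f x) := by
    filter_upwards [ae_restrict_mem measurableSet_Ioo] with x hx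
    exact mul_nonneg (hp x (Ioo_subset_Icc_self hx)).le (mul_self_nonneg _)
  have h1 := (integral_eq_zero_iff_of_nonneg_ae h0 (L2.integrable_weight hρ f f)).1 h
  refine Lp.ext ?_
  filter_upwards [h1, ae_restrict_mem measurableSet_Ioo,
    Lp.coeFn_zero ℝ 2 (volume.restrict (Ioo (0 : ℝ) L))] with x hx hm hz
  have := (hp x (Ioo_subset_Icc_self hm)).ne'
  rw [hz]
  simpa [this] using hx

theorem L2.integrable_mul_bounded {L : ℝ} (f : L2 L) {φ : ℝ → ℝ} (hφ : Continuous φ) :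
    Integrable (fun x => f x * φ x) (volume.restrict (Ioo 0 L)) := by
  have h : Integrable f (volume.restrict (Ioo (0 : ℝ) L)) :=
    (Lp.memLp f).integrable (by norm_num)
  obtain ⟨C, hC⟩ := isCompact_Icc.exists_bound_of_continuousOn (s := Icc 0 L) hφ.continuousOn
  refine h.mul_bdd (c := C) hφ.aestronglyMeasurable ?_
  filter_upwards [ae_restrict_mem measurableSet_Ioo] with x hx
  exact hC x (Ioo_subset_Icc_self hx)

theorem IsTestFun.continuous_deriv {a b : ℝ} {φ : ℝ → ℝ} (h : IsTestFun a b φ) :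
    Continuous (deriv φ) :=
  h.smooth.continuous_deriv (by simp)

theorem HasWeakDerivOn.add {L : ℝ} {f g f' g' : L2 L} (h : HasWeakDerivOn 0 L f g)
    (h' : HasWeakDerivOn 0 L f' g') : HasWeakDerivOn 0 L (f + f' : L2 L) (g + g' : L2 L) := by
  intro φ hφ
  have e1 : ∫ x in Ioo 0 L, (f + f' : L2 L) x * deriv φ x
      = ∫ x in Ioo 0 L, (f x * deriv φ x + f' x * deriv φ x) := by
    refine integral_congr_ae ?_
    filter_upwards [Lp.coeFn_add f f'] with x hx
    rw [hx, Pi.add_apply]; ring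
  have e2 : ∫ x in Ioo 0 L, (g + g' : L2 L) x * φ x
      = ∫ x in Ioo 0 L, (g x * φ x + g' x * φ x) := by
    refine integral_congr_ae ?_
    filter_upwards [Lp.coeFn_add g g'] with x hx
    rw [hx, Pi.add_apply]; ring
  rw [e1, e2, integral_add (L2.integrable_mul_bounded f hφ.continuous_deriv)
    (L2.integrable_mul_bounded f' hφ.continuous_deriv),
    integral_add (L2.integrable_mul_bounded g hφ.smooth.continuous)
    (L2.integrable_mul_bounded g' hφ.smooth.continuous), h φ hφ, h' φ hφ]
  ring

theorem HasWeakDerivOn.smul {L : ℝ} {f g : L2 L} (r : ℝ) (h : HasWeakDerivOn 0 L f g) :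
    HasWeakDerivOn 0 L (r • f : L2 L) (r • g : L2 L) := by
  intro φ hφ
  have e1 : ∫ x in Ioo 0 L, (r • f : L2 L) x * deriv φ x
      = r * ∫ x in Ioo 0 L, f x * deriv φ x := by
    rw [← integral_const_mul]
    refine integral_congr_ae ?_
    filter_upwards [Lp.coeFn_smul r f] with x hx
    rw [hx, Pi.smul_apply, smul_eq_mul]; ring
  have e2 : ∫ x in Ioo 0 L, (r • g : L2 L) x * φ x = r * ∫ x in Ioo 0 L, g x * φ x := by
    rw [← integral_const_mul]
    refine integral_congr_ae ?_
    filter_upwards [Lp.coeFn_smul r g] with x hx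
    rw [hx, Pi.smul_apply, smul_eq_mul]; ring
  rw [e1, e2, h φ hφ]
  ring

theorem HasTrace.add {L x r r' : ℝ} {f f' : L2 L} (h : HasTrace L f x r)
    (h' : HasTrace L f' x r') : HasTrace L (f + f' : L2 L) x (r + r') := by
  obtain ⟨F, hF, hf, rfl⟩ := h
  obtain ⟨F', hF', hf', rfl⟩ := h'
  exact ⟨F + F', hF.add hF', (Lp.coeFn_add f f').trans (hf.add hf'), rfl⟩

theorem HasTrace.smul {L x r : ℝ} {f : L2 L} (a : ℝ) (h : HasTrace L f x r) :
    HasTrace L (a • f : L2 L) x (a * r) := by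
  obtain ⟨F, hF, hf, rfl⟩ := h
  exact ⟨a • F, hF.const_smul a, (Lp.coeFn_smul a f).trans (hf.const_smul a), rfl⟩

theorem HasTrace.zero (L x : ℝ) : HasTrace L (0 : L2 L) x 0 :=
  ⟨0, continuousOn_const, Lp.coeFn_zero ℝ 2 _, rfl⟩

theorem HasWeakDerivOn.zero (L : ℝ) : HasWeakDerivOn 0 L (0 : L2 L) (0 : L2 L) := by
  simpa using HasWeakDerivOn.smul (f := 0) (g := 0) 0 (fun φ hφ => by
    have e : ∀ ψ : ℝ → ℝ, ∫ x in Ioo 0 L, (0 : L2 L) x * ψ x = 0 := fun ψ => by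
      refine integral_eq_zero_of_ae ?_
      filter_upwards [Lp.coeFn_zero ℝ 2 (volume.restrict (Ioo (0 : ℝ) L))] with x hx
      rw [hx]; simp
    rw [e, e, neg_zero])

theorem HasTrace.unique {L x r r' : ℝ} (hL : 0 < L) {f : ℝ → ℝ} (hx : x ∈ Icc 0 L)
    (h : HasTrace L f x r) (h' : HasTrace L f x r') : r = r' := by
  obtain ⟨F, hF, hf, rfl⟩ := h
  obtain ⟨F', hF', hf', rfl⟩ := h'
  refine Measure.eqOn_Icc_of_ae_eq volume hL.ne ?_ hF hF' hx
  rw [← restrict_Ioo_eq_restrict_Icc]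
  exact hf.symm.trans hf'

theorem ae_eq_zero_of_test {L : ℝ} {f : ℝ → ℝ}
    (hf : Integrable f (volume.restrict (Ioo 0 L)))
    (h : ∀ φ, IsTestFun 0 L φ → ∫ x in Ioo 0 L, f x * φ x = 0) :
    f =ᵐ[volume.restrict (Ioo 0 L)] 0 := by
  have := isOpen_Ioo.ae_eq_zero_of_integral_contDiff_smul_eq_zero (μ := volume) (f := f)
    (U := Ioo (0 : ℝ) L) (IntegrableOn.locallyIntegrableOn hf) (fun g h1 h2 h3 => by
      rw [← h g ⟨h1, h2, h3⟩, ← setIntegral_eq_integral_of_forall_compl_eq_zero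
        (s := Ioo (0 : ℝ) L)]
      · simp [mul_comm]
      · intro x hx
        rw [image_eq_zero_of_notMem_tsupport (fun hh => hx (h3 hh)), zero_smul])
  exact (ae_restrict_iff' measurableSet_Ioo).2 this

theorem HasWeakDerivOn.unique {L : ℝ} {f g g' : L2 L} (h : HasWeakDerivOn 0 L f g)
    (h' : HasWeakDerivOn 0 L f g') : g = g' := by
  have key := ae_eq_zero_of_test (L := L) (f := fun x => g x - g' x)
    (((Lp.memLp g).integrable (by norm_num)).sub ((Lp.memLp g').integrable (by norm_num)))
    (fun φ hφ => by
      simp only [sub_mul]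
      rw [integral_sub (L2.integrable_mul_bounded g hφ.smooth.continuous)
        (L2.integrable_mul_bounded g' hφ.smooth.continuous)]
      linarith [h φ hφ, h' φ hφ])
  refine Lp.ext ?_
  filter_upwards [key] with x hx
  simpa [sub_eq_zero] using hx

theorem exists_primitive_test {a b : ℝ} {g : ℝ → ℝ} (hg : IsTestFun a b g)
    (h0 : ∫ x in Ioo a b, g x = 0) : ∃ φ, IsTestFun a b φ ∧ deriv φ = g := by
  by_cases hne : (tsupport g).Nonempty
  · have hK : IsCompact (tsupport g) := hg.compact
    obtain ⟨c, hc, hcm⟩ := hK.exists_isLeast hne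
    obtain ⟨e, he, hem⟩ := hK.exists_isGreatest hne
    have hca := (hg.supp hc).1
    have heb := (hg.supp he).2
    have hab : a < b := hca.trans (hg.supp hc).2
    have hz : ∀ x, x ∉ Icc c e → g x = 0 := fun x hx => by
      by_contra hne
      have hm : x ∈ tsupport g := subset_tsupport g hne
      exact hx ⟨hcm hm, hem hm⟩
    have hd : ∀ x, HasDerivAt (fun y => ∫ t in a..y, g t) (g x) x := fun x =>
      intervalIntegral.integral_hasDerivAt_right
        (hg.smooth.continuous.intervalIntegrable _ _)
        hg.smooth.continuous.stronglyMeasurable.stronglyMeasurableAtFilter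
        hg.smooth.continuous.continuousAt
    have hderiv : deriv (fun y => ∫ t in a..y, g t) = g := funext fun x => (hd x).deriv
    have hsupp : Function.support (fun y => ∫ t in a..y, g t) ⊆ Icc c e := by
      intro x hx
      by_contra hxn
      apply hx
      by_cases hxc : x < c
      · refine intervalIntegral.integral_zero_ae (Filter.Eventually.of_forall fun t ht => ?_)
        refine hz t fun hmem => ?_
        have : t ≤ max a x := (mem_uIoc.1 ht).elim (fun q => q.2.trans (le_max_right _ _))
          (fun q => q.2.trans (le_max_left _ _))
        exact absurd (hmem.1.trans this) (not_le.2 (max_lt hca hxc))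
      · have hex : e < x := by
          by_contra hle
          exact hxn ⟨not_lt.1 hxc, not_lt.1 hle⟩
        have e1 : ∫ t in a..b, g t = 0 := by
          rw [intervalIntegral.integral_of_le hab.le, integral_Ioc_eq_integral_Ioo, h0]
        have e2 : ∫ t in b..x, g t = 0 := by
          refine intervalIntegral.integral_zero_ae (Filter.Eventually.of_forall fun t ht => ?_)
          refine hz t fun hmem => ?_
          have : min b x < t := (mem_uIoc.1 ht).elim (fun q => (min_le_left _ _).trans_lt q.1)
            (fun q => (min_le_right _ _).trans_lt q.1)
          exact absurd hmem.2 (not_le.2 ((lt_min heb hex).trans this))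
        have := intervalIntegral.integral_add_adjacent_intervals
          (hg.smooth.continuous.intervalIntegrable (μ := volume) a b)
          (hg.smooth.continuous.intervalIntegrable (μ := volume) b x)
        simp only
        rw [← this, e1, e2, add_zero]
    have hts : tsupport (fun y => ∫ t in a..y, g t) ⊆ Icc c e :=
      closure_minimal hsupp isClosed_Icc
    refine ⟨_, ⟨?_, ?_, ?_⟩, hderiv⟩
    · rw [contDiff_infty_iff_deriv, hderiv]
      exact ⟨fun x => (hd x).differentiableAt, hg.smooth⟩
    · exact isCompact_Icc.of_isClosed_subset (isClosed_tsupport _) hts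
    · exact hts.trans (Icc_subset_Ioo hca heb)
  · have hg0 : g = 0 := by
      rw [← tsupport_eq_empty_iff]
      exact not_nonempty_iff_eq_empty.1 hne
    refine ⟨0, ⟨contDiff_const, HasCompactSupport.zero, by simp [tsupport]⟩, ?_⟩
    rw [hg0]; ext x; simp

/-- Du Bois-Reymond: a function with zero weak derivative is constant. -/
theorem ae_const_of_weakDeriv_zero {L : ℝ} (hL : 0 < L) {f : L2 L}
    (h : HasWeakDerivOn 0 L f (0 : L2 L)) :
    ∃ r : ℝ, f =ᵐ[volume.restrict (Ioo 0 L)] fun _ => r := by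
  let β : ContDiffBump (L / 2) := ⟨L / 8, L / 4, by positivity, by linarith⟩
  let ψ : ℝ → ℝ := β.normed volume
  have hψ : IsTestFun 0 L ψ := by
    refine ⟨β.contDiff_normed, β.hasCompactSupport_normed, ?_⟩
    rw [β.tsupport_normed_eq]
    intro x hx
    rw [Metric.mem_closedBall, Real.dist_eq] at hx
    have := abs_le.1 hx
    change -(L / 4) ≤ _ ∧ _ ≤ L / 4 at this
    constructor <;> linarith [this.1, this.2]
  have hψ1 : ∫ x in Ioo 0 L, ψ x = 1 := by
    rw [setIntegral_eq_integral_of_forall_compl_eq_zero]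
    · exact β.integral_normed
    · intro x hx
      exact image_eq_zero_of_notMem_tsupport (fun hh => hx (hψ.supp hh))
  have hfi : Integrable f (volume.restrict (Ioo (0 : ℝ) L)) :=
    (Lp.memLp f).integrable (by norm_num)
  set r : ℝ := ∫ x in Ioo 0 L, f x * ψ x with hr
  have key := ae_eq_zero_of_test (L := L) (f := fun x => f x - r)
    (hfi.sub (integrable_const r)) (fun φ hφ => by
      have hφi : ∀ {χ : ℝ → ℝ}, Continuous χ →
          Integrable χ (volume.restrict (Ioo (0 : ℝ) L)) := fun hχ =>
        (hχ.continuousOn.integrableOn_compact isCompact_Icc).mono_set Ioo_subset_Icc_self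
      set s : ℝ := ∫ x in Ioo 0 L, φ x with hs
      have ht : IsTestFun 0 L (fun x => φ x - s * ψ x) := by
        refine ⟨hφ.smooth.sub (contDiff_const.mul hψ.smooth), ?_, ?_⟩
        · exact hφ.compact.sub hψ.compact.mul_left
        · refine (closure_mono ?_).trans
            ((closure_union (s := Function.support φ) (t := Function.support ψ)).subset.trans
              (union_subset hφ.supp hψ.supp))
          intro x hx
          by_contra hn
          simp only [mem_union, Function.mem_support, not_or, not_not] at hn
          exact hx (by simp [hn.1, hn.2])
      obtain ⟨χ, hχ, hχd⟩ := exists_primitive_test ht (by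
        rw [integral_sub (hφi hφ.smooth.continuous)
          ((hφi hψ.smooth.continuous).const_mul s), integral_const_mul, hψ1, ← hs]
        ring)
      have h1 := h χ hχ
      have h2 : ∫ x in Ioo 0 L, (0 : L2 L) x * χ x = 0 := by
        refine integral_eq_zero_of_ae ?_
        filter_upwards [Lp.coeFn_zero ℝ 2 (volume.restrict (Ioo (0 : ℝ) L))] with x hx
        rw [hx]; simp
      rw [hχd, h2, neg_zero] at h1
      have h3 : ∫ x in Ioo 0 L, f x * (φ x - s * ψ x)
          = (∫ x in Ioo 0 L, f x * φ x) - s * r := by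
        rw [hr, ← integral_const_mul, ← integral_sub
          (L2.integrable_mul_bounded f hφ.smooth.continuous)
          ((L2.integrable_mul_bounded f hψ.smooth.continuous).const_mul s)]
        congr 1; ext x; ring
      simp only [sub_mul]
      rw [integral_sub (L2.integrable_mul_bounded f hφ.smooth.continuous)
        ((hφi hφ.smooth.continuous).const_mul r), integral_const_mul, ← hs]
      linarith)
  refine ⟨r, ?_⟩
  filter_upwards [key] with x hx
  simpa [sub_eq_zero] using hx

theorem eq_zero_of_weakDeriv_zero {L : ℝ} (hL : 0 < L) {f : L2 L}
    (h : HasWeakDerivOn 0 L f (0 : L2 L)) (h0 : HasTrace L f 0 0) : f = 0 := by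
  obtain ⟨r, hr⟩ := ae_const_of_weakDeriv_zero hL h
  have : (0 : ℝ) = r := h0.unique hL (left_mem_Icc.2 hL.le) ⟨fun _ => r, continuousOn_const, hr, rfl⟩
  subst this
  refine Lp.ext (hr.trans ?_)
  filter_upwards [Lp.coeFn_zero ℝ 2 (volume.restrict (Ioo (0 : ℝ) L))] with x hx
  rw [hx]; rfl

/-! ### The Hilbert spaces `H` and `V` -/

namespace Beam

variable (B : Beam)

/-- The space `H = ℝ × ℝ × L²(0, L)`. -/
def H : Type := ℝ × ℝ × L2 B.L

section

noncomputable local instance groupH : AddCommGroup B.H :=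
  inferInstanceAs (AddCommGroup (ℝ × ℝ × L2 B.L))

noncomputable local instance moduleH : Module ℝ B.H :=
  inferInstanceAs (Module ℝ (ℝ × ℝ × L2 B.L))

variable {B}

/-- The first component `¹φ`. -/
def H.slope (φ : B.H) : ℝ := φ.1

/-- The second component `²φ`. -/
def H.tip (φ : B.H) : ℝ := φ.2.1

/-- The third component `³φ`. -/
def H.field (φ : B.H) : L2 B.L := φ.2.2

variable (B)

/-- The inner product `(φ, ν)_H = J ¹φ ¹ν + M ²φ ²ν + (μ ³φ, ³ν)_{L²}`. -/
noncomputable def innerH (φ ν : B.H) : ℝ :=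
  B.J * (φ.slope * ν.slope) + B.M * (φ.tip * ν.tip) + weighted B.μ φ.field ν.field

/-- `innerH` is an inner product. -/
noncomputable abbrev coreH : InnerProductSpace.Core ℝ B.H where
  inner := B.innerH
  conj_inner_symm φ ν := by
    change B.innerH ν φ = B.innerH φ ν
    simp only [innerH, weighted_comm B.μ ν.field, mul_comm ν.slope, mul_comm ν.tip]
  re_inner_nonneg φ := by
    change 0 ≤ B.innerH φ φ
    have := weighted_nonneg B.μ_pos φ.field
    have h1 := mul_nonneg B.J_pos.le (mul_self_nonneg φ.slope)
    have h2 := mul_nonneg B.M_pos.le (mul_self_nonneg φ.tip)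
    unfold innerH
    linarith
  add_left φ φ' ν := by
    change B.innerH (φ + φ') ν = B.innerH φ ν + B.innerH φ' ν
    change B.J * ((φ.slope + φ'.slope) * ν.slope) + B.M * ((φ.tip + φ'.tip) * ν.tip)
      + weighted B.μ (φ.field + φ'.field) ν.field = _
    rw [weighted_add B.μ_smooth.continuousOn]
    unfold innerH
    ring
  smul_left φ ν r := by
    change B.innerH (r • φ) ν = r * B.innerH φ ν
    change B.J * ((r * φ.slope) * ν.slope) + B.M * ((r * φ.tip) * ν.tip)
      + weighted B.μ (r • φ.field) ν.field = _
    rw [weighted_smul]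
    unfold innerH
    ring
  definite φ h := by
    change B.innerH φ φ = 0 at h
    have h0 := weighted_nonneg B.μ_pos φ.field
    have h1 := mul_nonneg B.J_pos.le (mul_self_nonneg φ.slope)
    have h2 := mul_nonneg B.M_pos.le (mul_self_nonneg φ.tip)
    unfold innerH at h
    have e1 : B.J * (φ.slope * φ.slope) = 0 := by linarith
    have e2 : B.M * (φ.tip * φ.tip) = 0 := by linarith
    have e3 : weighted B.μ φ.field φ.field = 0 := by linarith
    have f1 : φ.slope = 0 := by simpa [B.J_pos.ne'] using e1
    have f2 : φ.tip = 0 := by simpa [B.M_pos.ne'] using e2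
    have f3 : φ.field = 0 := weighted_definite B.μ_smooth.continuousOn B.μ_pos _ e3
    exact Prod.ext f1 (Prod.ext f2 f3)

noncomputable instance : NormedAddCommGroup B.H := B.coreH.toNormedAddCommGroup

noncomputable instance : InnerProductSpace ℝ B.H := InnerProductSpace.ofCore B.coreH.toCore

end

theorem inner_H_eq (φ ν : B.H) : ⟪φ, ν⟫ = B.innerH φ ν := rfl

/-- `φ = (w_x(L), w(L), w)` with `w ∈ H²(0, L)`, `w(0) = w_x(0) = 0`, where `w_x = w₁` and
`w_xx = w₂` in the weak sense. -/
structure IsHat (φ : B.H) (w₁ w₂ : L2 B.L) : Prop where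
  deriv₁ : HasWeakDerivOn 0 B.L φ.field w₁
  deriv₂ : HasWeakDerivOn 0 B.L w₁ w₂
  clamped : HasTrace B.L φ.field 0 0
  clamped' : HasTrace B.L w₁ 0 0
  slope_eq : HasTrace B.L w₁ B.L φ.slope
  tip_eq : HasTrace B.L φ.field B.L φ.tip

variable {B}

theorem IsHat.add {φ φ' : B.H} {w₁ w₂ w₁' w₂' : L2 B.L} (h : B.IsHat φ w₁ w₂)
    (h' : B.IsHat φ' w₁' w₂') : B.IsHat (φ + φ') (w₁ + w₁') (w₂ + w₂') where
  deriv₁ := h.deriv₁.add h'.deriv₁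
  deriv₂ := h.deriv₂.add h'.deriv₂
  clamped := by
    have := h.clamped.add h'.clamped
    rwa [add_zero] at this
  clamped' := by simpa using h.clamped'.add h'.clamped'
  slope_eq := h.slope_eq.add h'.slope_eq
  tip_eq := h.tip_eq.add h'.tip_eq

theorem IsHat.smul {φ : B.H} {w₁ w₂ : L2 B.L} (r : ℝ) (h : B.IsHat φ w₁ w₂) :
    B.IsHat (r • φ) (r • w₁) (r • w₂) where
  deriv₁ := h.deriv₁.smul r
  deriv₂ := h.deriv₂.smul r
  clamped := by
    have := h.clamped.smul r
    rwa [mul_zero] at this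
  clamped' := by simpa using h.clamped'.smul r
  slope_eq := h.slope_eq.smul r
  tip_eq := h.tip_eq.smul r

variable (B)

theorem IsHat.zero : B.IsHat 0 0 0 where
  deriv₁ := HasWeakDerivOn.zero B.L
  deriv₂ := HasWeakDerivOn.zero B.L
  clamped := HasTrace.zero _ _
  clamped' := HasTrace.zero _ _
  slope_eq := HasTrace.zero _ _
  tip_eq := HasTrace.zero _ _

/-- `V = {(w_x(L), w(L), w) : w ∈ H²(0, L), w(0) = w_x(0) = 0}` as a linear subspace of `H`. -/
def subV : Submodule ℝ B.H where
  carrier := {φ | ∃ w₁ w₂, B.IsHat φ w₁ w₂}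
  zero_mem' := ⟨0, 0, IsHat.zero B⟩
  add_mem' := by
    rintro φ φ' ⟨w₁, w₂, h⟩ ⟨w₁', w₂', h'⟩
    exact ⟨_, _, h.add h'⟩
  smul_mem' := by
    rintro r φ ⟨w₁, w₂, h⟩
    exact ⟨_, _, h.smul r⟩

/-- The space `V`, as a type of its own since its norm is not that of `H`. -/
def V : Type := B.subV

section

noncomputable local instance groupV : AddCommGroup B.V := inferInstanceAs (AddCommGroup B.subV)

noncomputable local instance moduleV : Module ℝ B.V := inferInstanceAs (Module ℝ B.subV)

variable {B}

/-- The inclusion `V ⊂ H`. -/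
def V.toH (w : B.V) : B.H := Subtype.val (p := fun φ => φ ∈ B.subV) w

/-- The weak derivative `w_xx` of `ŵ = (w_x(L), w(L), w) ∈ V`. -/
noncomputable def V.dxx (w : B.V) : L2 B.L :=
  (show ∃ w₁ w₂, B.IsHat w.toH w₁ w₂ from w.2).choose_spec.choose

theorem V.exists_isHat (w : B.V) : ∃ w₁, B.IsHat w.toH w₁ w.dxx :=
  ⟨_, (show ∃ w₁ w₂, B.IsHat w.toH w₁ w₂ from w.2).choose_spec.choose_spec⟩

theorem V.dxx_eq {w : B.V} {w₁ w₂ : L2 B.L} (h : B.IsHat w.toH w₁ w₂) : w.dxx = w₂ := by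
  obtain ⟨w₁', h'⟩ := w.exists_isHat
  have e := h'.deriv₁.unique h.deriv₁
  subst e
  exact h'.deriv₂.unique h.deriv₂

theorem V.dxx_add (w w' : B.V) : (w + w').dxx = w.dxx + w'.dxx := by
  obtain ⟨w₁, h⟩ := w.exists_isHat
  obtain ⟨w₁', h'⟩ := w'.exists_isHat
  exact V.dxx_eq (w := w + w') (h.add h')

theorem V.dxx_smul (r : ℝ) (w : B.V) : (r • w).dxx = r • w.dxx := by
  obtain ⟨w₁, h⟩ := w.exists_isHat
  exact V.dxx_eq (w := r • w) (h.smul r)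

theorem V.eq_zero_of_dxx {w : B.V} (h : w.dxx = 0) : w = 0 := by
  obtain ⟨w₁, hw⟩ := w.exists_isHat
  rw [h] at hw
  have e1 : w₁ = 0 := eq_zero_of_weakDeriv_zero B.L_pos hw.deriv₂ hw.clamped'
  subst e1
  have e0 : w.toH.field = 0 := eq_zero_of_weakDeriv_zero B.L_pos hw.deriv₁ hw.clamped
  have hR : B.L ∈ Icc 0 B.L := right_mem_Icc.2 B.L_pos.le
  have e2 : w.toH.slope = 0 := hw.slope_eq.unique B.L_pos hR (HasTrace.zero _ _)
  have e3 : w.toH.tip = 0 := by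
    have := hw.tip_eq
    rw [e0] at this
    exact this.unique B.L_pos hR (HasTrace.zero _ _)
  exact Subtype.ext (Prod.ext e2 (Prod.ext e3 e0))

variable (B)

/-- The inner product `(v̂, ŵ)_V = (Λ v_xx, w_xx)_{L²}`. -/
noncomputable def innerV (v w : B.V) : ℝ := weighted B.Λ v.dxx w.dxx

/-- `innerV` is an inner product. -/
noncomputable abbrev coreV : InnerProductSpace.Core ℝ B.V where
  inner := B.innerV
  conj_inner_symm v w := weighted_comm _ _ _
  re_inner_nonneg v := weighted_nonneg B.Λ_pos v.dxx
  add_left v v' w := by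
    change weighted _ _ _ = weighted _ _ _ + weighted _ _ _
    rw [V.dxx_add, weighted_add B.Λ_smooth.continuousOn]
  smul_left v w r := by
    change weighted _ _ _ = r * weighted _ _ _
    rw [V.dxx_smul, weighted_smul]
  definite v h :=
    V.eq_zero_of_dxx (weighted_definite B.Λ_smooth.continuousOn B.Λ_pos _ h)

noncomputable instance : NormedAddCommGroup B.V := B.coreV.toNormedAddCommGroup

noncomputable instance : InnerProductSpace ℝ B.V := InnerProductSpace.ofCore B.coreV.toCore

end

theorem inner_V_eq (v w : B.V) : ⟪v, w⟫ = B.innerV v w := rfl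

end Beam

/-! ### Weak solutions -/

section WeakSolution

variable {B : Beam} {n : ℕ}

/-- `a(v̂, ŵ) = (v̂, ŵ)_V + k₁ v_x(L) w_x(L) + k₂ v(L) w(L)`. -/
noncomputable def formA (K₁ K₂ : Controller n) (v w : B.V) : ℝ :=
  ⟪v, w⟫ + K₁.k * v.toH.slope * w.toH.slope + K₂.k * v.toH.tip * w.toH.tip

/-- `b(φ, ν) = d₁ ¹φ ¹ν + d₂ ²φ ²ν`. -/
def formB (K₁ K₂ : Controller n) (φ ν : B.H) : ℝ :=
  K₁.d * φ.slope * ν.slope + K₂.d * φ.tip * ν.tip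

/-- `e₁(ζ, ŵ) = (c₁ · ζ) w_x(L)`. -/
def formE₁ (K₁ : Controller n) (ζ : Fin n → ℝ) (w : B.V) : ℝ := (K₁.c ⬝ᵥ ζ) * w.toH.slope

/-- `e₂(ζ, ŵ) = (c₂ · ζ) w(L)`. -/
def formE₂ (K₂ : Controller n) (ζ : Fin n → ℝ) (w : B.V) : ℝ := (K₂.c ⬝ᵥ ζ) * w.toH.tip

/-- The measure `dt` on `(0, T)`. -/
noncomputable abbrev timeMeasure (T : ℝ) : Measure ℝ := volume.restrict (Ioo 0 T)

/-- `ut` is the weak time derivative on `(0, T)` of the `H`-valued function `u`. -/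
def HasWeakTimeDerivH (T : ℝ) (u ut : ℝ → B.H) : Prop :=
  ∀ h : B.H, HasWeakDerivOn 0 T (fun t => ⟪u t, h⟫) (fun t => ⟪ut t, h⟫)

/-- The `V'`-valued function `vt` is the weak time derivative on `(0, T)` of the `H`-valued
function `v`, where `φ ∈ H` is identified with the functional `(φ, ·)_H ∈ V'`. -/
def HasWeakTimeDerivV' (T : ℝ) (v : ℝ → B.H) (vt : ℝ → StrongDual ℝ B.V) : Prop :=
  ∀ w : B.V, HasWeakDerivOn 0 T (fun t => ⟪v t, w.toH⟫) (fun t => vt t w)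

/-- `ζ ∈ H¹(0, T; ℝⁿ)` satisfies `ζ_t = A ζ + b y` a.e. on `(0, T)`, and (the continuous
representative of) `ζ` has the initial value `ζ₀`. -/
def SolvesController (T : ℝ) (K : Controller n) (y : ℝ → ℝ) (ζ₀ : Fin n → ℝ)
    (ζ : ℝ → Fin n → ℝ) : Prop :=
  ∃ ζt : ℝ → Fin n → ℝ,
    MemLp ζ 2 (timeMeasure T) ∧ MemLp ζt 2 (timeMeasure T) ∧
    (∀ i, HasWeakDerivOn 0 T (fun t => ζ t i) (fun t => ζt t i)) ∧
    (∀ᵐ t ∂timeMeasure T, ζt t = K.A *ᵥ ζ t + y t • K.b) ∧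
    ∃ ζc : ℝ → Fin n → ℝ,
      ContinuousOn ζc (Icc 0 T) ∧ ζ =ᵐ[timeMeasure T] ζc ∧ ζc 0 = ζ₀

/-- `(u, ζ₁, ζ₂)` is a weak solution on `(0, T)` of the beam equation coupled to the controllers
`K₁` and `K₂`, with the initial values `u₀ ∈ V`, `v₀ ∈ H`, `ζ₁₀` and `ζ₂₀`. The initial values
of `u` and `u_t` are those of the representatives in `C([0, T]; H)` and `C([0, T]; V')`. -/
def IsWeakSolution (T : ℝ) (K₁ K₂ : Controller n) (u₀ : B.V) (v₀ : B.H) (ζ₁₀ ζ₂₀ : Fin n → ℝ)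
    (u : ℝ → B.V) (ζ₁ ζ₂ : ℝ → Fin n → ℝ) : Prop :=
  ∃ (ut : ℝ → B.H) (utt : ℝ → StrongDual ℝ B.V),
    MemLp u 2 (timeMeasure T) ∧ MemLp ut 2 (timeMeasure T) ∧ MemLp utt 2 (timeMeasure T) ∧
    HasWeakTimeDerivH T (fun t => (u t).toH) ut ∧
    HasWeakTimeDerivV' T ut utt ∧
    (∀ᵐ t ∂timeMeasure T, ∀ w : B.V,
      utt t w + formA K₁ K₂ (u t) w + formB K₁ K₂ (ut t) w.toH
        + formE₁ K₁ (ζ₁ t) w + formE₂ K₂ (ζ₂ t) w = 0) ∧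
    SolvesController T K₁ (fun t => (ut t).slope) ζ₁₀ ζ₁ ∧
    SolvesController T K₂ (fun t => (ut t).tip) ζ₂₀ ζ₂ ∧
    (∃ uc : ℝ → B.H, ContinuousOn uc (Icc 0 T) ∧
      (∀ᵐ t ∂timeMeasure T, (u t).toH = uc t) ∧ uc 0 = u₀.toH) ∧
    (∃ vc : ℝ → StrongDual ℝ B.V, ContinuousOn vc (Icc 0 T) ∧
      (∀ᵐ t ∂timeMeasure T, ∀ w : B.V, vc t w = ⟪ut t, w.toH⟫) ∧
      ∀ w : B.V, vc 0 w = ⟪v₀, w.toH⟫)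

end WeakSolution

end PiezoBeam

namespace PiezoBeam

/-! ### Primitives of square integrable functions -/

/-! The coupled system has the form `ü + u = f` in `V'`, where `u` acts as `(u, ·)_V` and `f`
collects all remaining terms. Those terms see a test vector only through its tip slope and tip
displacement. As the tip body has positive mass and moment of inertia, both components are bounded
functionals on `H`, so `f ∈ L²(0,T;H)`. What remains is an abstract regularity statement for such
equations, `exists_continuousOn_energy`.

Formally, testing with `u_t` gives `d/dt (‖u‖_V² + ‖u_t‖_H²) = 2 (f, u_t)_H`, but `u_t` takes values
only in `H` and is not an admissible test vector. Mollification in time repairs this. The derivative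
falls on the kernel, so the mollified `u` is differentiable with values in `V`, the mollified `u_t`
is differentiable with values in `H`, and the equation survives (`map_mollify_deriv`,
`inner_mollify_deriv`). The energy identity then bounds the supremum of the energy by the `L²` norms
of `u`, `u_t` and `f` (`energy_le`). By linearity this applies to the difference of two
mollifications. Since mollifications converge in `L²` (`tendsto_eLpNorm_mollify_sub`), they are
uniformly Cauchy in `V` and in `H`, and their limits are the continuous representatives.

Kernels symmetric about `0` would leave `(0,T)` near its ends. Kernels supported on one side of `0`
avoid this: on `[0, 2T/3]` they look forward in time, on `[T/3, T]` backward, and the two results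
are glued on the overlap. The vector-valued integrals and limits need `H` and `V` to be complete;
for `V` this holds because `w ↦ w_xx` is an isomorphism onto `L²(0,L)`, with the double primitive as
its inverse. -/

theorem L2.intervalIntegrable {L : ℝ} (hL : 0 < L) (g : L2 L) :
    IntervalIntegrable g volume 0 L := by
  rw [intervalIntegrable_iff_integrableOn_Ioo_of_le hL.le]
  exact (Lp.memLp g).integrable (by norm_num)

/-- Integration by parts for absolutely continuous functions; the boundary terms vanish because a
test function is zero at both ends. -/
theorem hasWeakDerivOn_primitive {L : ℝ} (hL : 0 < L) {g : ℝ → ℝ}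
    (hg : IntervalIntegrable g volume 0 L) :
    HasWeakDerivOn 0 L (fun x => ∫ t in 0..x, g t) g := by
  intro φ hφ
  have hac := hg.absolutelyContinuousOnInterval_intervalIntegral (c := 0) (by simp)
  have hφac : AbsolutelyContinuousOnInterval φ 0 L :=
    (hφ.smooth.of_le (by norm_cast)).contDiffOn.absolutelyContinuousOnInterval
  have h := hac.integral_mul_deriv_eq_deriv_mul hφac
  have z : ∀ x, x ∉ Ioo 0 L → φ x = 0 := fun x hx =>
    image_eq_zero_of_notMem_tsupport fun hh => hx (hφ.supp hh)
  rw [z 0 (by simp), z L (by simp), mul_zero, mul_zero, sub_zero, zero_sub] at h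
  rw [← integral_Ioc_eq_integral_Ioo, ← intervalIntegral.integral_of_le hL.le, h,
    ← integral_Ioc_eq_integral_Ioo, ← intervalIntegral.integral_of_le hL.le]
  congr 1
  refine intervalIntegral.integral_congr_ae ?_
  filter_upwards [hg.ae_hasDerivAt_integral] with x hx hxm
  rw [(hx (uIoc_subset_uIcc hxm) 0 (by simp)).deriv]

theorem continuousOn_primitive {L : ℝ} (hL : 0 < L) (g : L2 L) :
    ContinuousOn (fun x => ∫ t in 0..x, g t) (Icc 0 L) := by
  have := (L2.intervalIntegrable hL g).absolutelyContinuousOnInterval_intervalIntegral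
    (c := 0) (by simp)
  simpa [uIcc_of_le hL.le] using this.continuousOn

theorem memLp_primitive {L : ℝ} (hL : 0 < L) (g : L2 L) :
    MemLp (fun x => ∫ t in 0..x, g t) 2 (volume.restrict (Ioo 0 L)) := by
  obtain ⟨C, hC⟩ := isCompact_Icc.exists_bound_of_continuousOn (continuousOn_primitive hL g)
  refine MemLp.of_bound (((continuousOn_primitive hL g).mono
    Ioo_subset_Icc_self).aestronglyMeasurable measurableSet_Ioo) C ?_
  filter_upwards [ae_restrict_mem measurableSet_Ioo] with x hx
  exact hC x (Ioo_subset_Icc_self hx)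

/-- The primitive of `g` which vanishes at `0`. -/
noncomputable def L2.primitive {L : ℝ} (hL : 0 < L) (g : L2 L) : L2 L :=
  (memLp_primitive hL g).toLp _

theorem L2.coeFn_primitive {L : ℝ} (hL : 0 < L) (g : L2 L) :
    L2.primitive hL g =ᵐ[volume.restrict (Ioo 0 L)] fun x => ∫ t in 0..x, g t :=
  MemLp.coeFn_toLp _

theorem L2.hasWeakDerivOn_primitive {L : ℝ} (hL : 0 < L) (g : L2 L) :
    HasWeakDerivOn 0 L (L2.primitive hL g) g := by
  intro φ hφ
  rw [← PiezoBeam.hasWeakDerivOn_primitive hL (L2.intervalIntegrable hL g) φ hφ]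
  refine integral_congr_ae ?_
  filter_upwards [L2.coeFn_primitive hL g] with x hx
  rw [hx]

theorem L2.hasTrace_primitive {L : ℝ} (hL : 0 < L) (g : L2 L) (x : ℝ) :
    HasTrace L (L2.primitive hL g) x (∫ t in 0..x, g t) :=
  ⟨_, continuousOn_primitive hL g, L2.coeFn_primitive hL g, rfl⟩

theorem L2.norm_sq_eq {L : ℝ} (f : L2 L) : ‖f‖ ^ 2 = ∫ x in Ioo 0 L, f x * f x := by
  rw [← real_inner_self_eq_norm_sq, MeasureTheory.L2.inner_def]
  rfl

/-- Cauchy–Schwarz against the constant function `1`, whose norm is `√L`. -/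
theorem L2.norm_intervalIntegral_le {L : ℝ} (hL : 0 < L) (g : L2 L) {x : ℝ} (hx : x ∈ Icc 0 L) :
    ‖∫ t in 0..x, g t‖ ≤ √L * ‖g‖ := by
  have hg : Integrable g (volume.restrict (Ioo (0 : ℝ) L)) :=
    (Lp.memLp g).integrable (by norm_num)
  have h1 : ‖∫ t in 0..x, g t‖ ≤ ∫ t in Ioo 0 L, ‖g t‖ := by
    refine (intervalIntegral.norm_integral_le_integral_norm hx.1).trans ?_
    rw [intervalIntegral.integral_of_le hx.1, ← integral_Ioc_eq_integral_Ioo]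
    refine setIntegral_mono_set ?_ (Filter.Eventually.of_forall fun _ => norm_nonneg _)
      (Ioc_subset_Ioc_right hx.2).eventuallyLE
    rw [integrableOn_Ioc_iff_integrableOn_Ioo]
    exact hg.norm
  refine h1.trans ?_
  have h2 := integral_mul_norm_le_Lp_mul_Lq (μ := volume.restrict (Ioo (0 : ℝ) L))
    (f := g) (g := fun _ => (1 : ℝ)) (p := 2) (q := 2) (by norm_num [Real.holderConjugate_iff])
    (by simpa using Lp.memLp g) (by simpa using memLp_const (1 : ℝ))
  simp only [norm_one, mul_one, Real.one_rpow, integral_const] at h2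
  refine h2.trans (le_of_eq ?_)
  have h3 : ∫ a in Ioo 0 L, ‖g a‖ ^ (2 : ℝ) = ‖g‖ ^ 2 := by
    rw [L2.norm_sq_eq]
    congr 1; ext a
    rw [Real.rpow_two, Real.norm_eq_abs, sq_abs, sq]
  rw [h3, ← Real.sqrt_eq_rpow, ← Real.sqrt_eq_rpow, Real.sqrt_sq (norm_nonneg _)]
  simp [measureReal_def, hL.le, mul_comm]

theorem L2.norm_primitive_le {L : ℝ} (hL : 0 < L) (g : L2 L) :
    ‖L2.primitive hL g‖ ≤ √L * (√L * ‖g‖) := by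
  refine le_of_sq_le_sq ?_ (by positivity)
  rw [L2.norm_sq_eq, mul_pow, Real.sq_sqrt hL.le]
  have h : ∫ x in Ioo 0 L, L2.primitive hL g x * L2.primitive hL g x
      ≤ ∫ x in Ioo 0 L, (√L * ‖g‖) ^ 2 := by
    refine integral_mono_ae ?_ (integrable_const _) ?_
    · simpa [sq] using MeasureTheory.L2.integrable_inner (𝕜 := ℝ) (L2.primitive hL g)
        (L2.primitive hL g)
    · filter_upwards [L2.coeFn_primitive hL g, ae_restrict_mem measurableSet_Ioo] with x hx hm
      rw [hx, ← sq, ← sq_abs]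
      exact pow_le_pow_left₀ (abs_nonneg _)
        (L2.norm_intervalIntegral_le hL g (Ioo_subset_Icc_self hm)) 2
  refine h.trans (le_of_eq ?_)
  simp [measureReal_def, hL.le]

theorem weighted_bounds {L : ℝ} (hL : 0 < L) {ρ : ℝ → ℝ} (hρ : ContinuousOn ρ (Icc 0 L))
    (hp : ∀ x ∈ Icc 0 L, 0 < ρ x) : ∃ m C : ℝ, 0 < m ∧ 0 < C ∧
      ∀ f : L2 L, m * ‖f‖ ^ 2 ≤ weighted ρ f f ∧ weighted ρ f f ≤ C * ‖f‖ ^ 2 := by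
  have hne : (Icc 0 L).Nonempty := nonempty_Icc.2 hL.le
  obtain ⟨p, hpm, hpmin⟩ := isCompact_Icc.exists_isMinOn hne hρ
  obtain ⟨q, hqm, hqmax⟩ := isCompact_Icc.exists_isMaxOn hne hρ
  have hi : ∀ f : L2 L, Integrable (fun x => f x * f x) (volume.restrict (Ioo (0 : ℝ) L)) :=
    fun f => by simpa [sq] using MeasureTheory.L2.integrable_inner (𝕜 := ℝ) f f
  refine ⟨ρ p, ρ q, hp p hpm, hp q hqm, fun f => ?_⟩
  rw [L2.norm_sq_eq, ← integral_const_mul, ← integral_const_mul]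
  constructor
  · refine integral_mono_ae ((hi f).const_mul _) (L2.integrable_weight hρ f f) ?_
    filter_upwards [ae_restrict_mem measurableSet_Ioo] with x hx
    exact mul_le_mul_of_nonneg_right (hpmin (Ioo_subset_Icc_self hx)) (mul_self_nonneg _)
  · refine integral_mono_ae (L2.integrable_weight hρ f f) ((hi f).const_mul _) ?_
    filter_upwards [ae_restrict_mem measurableSet_Ioo] with x hx
    exact mul_le_mul_of_nonneg_right (hqmax (Ioo_subset_Icc_self hx)) (mul_self_nonneg _)

/-! ### Completeness of `H` and `V` -/

theorem le_sqrt_inv_mul {c x y : ℝ} (hc : 0 < c) (hy : 0 ≤ y) (h : c * x ^ 2 ≤ y ^ 2) :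
    x ≤ √c⁻¹ * y := by
  refine le_of_sq_le_sq ?_ (by positivity)
  rw [mul_pow, Real.sq_sqrt (by positivity), inv_mul_eq_div, le_div_iff₀ hc]
  linarith

namespace Beam

variable (B : Beam)

theorem norm_H_sq (φ : B.H) : ‖φ‖ ^ 2
    = B.J * φ.slope ^ 2 + B.M * φ.tip ^ 2 + weighted B.μ φ.field φ.field := by
  rw [← real_inner_self_eq_norm_sq, inner_H_eq, innerH]
  ring

theorem norm_V_sq (v : B.V) : ‖v‖ ^ 2 = weighted B.Λ v.dxx v.dxx := by
  rw [← real_inner_self_eq_norm_sq, inner_V_eq, innerV]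

/-- The space `H` as the product it is built from. -/
def prodEquivH : (ℝ × ℝ × L2 B.L) ≃ₗ[ℝ] B.H where
  toFun x := x
  invFun x := x
  map_add' _ _ := rfl
  map_smul' _ _ := rfl
  left_inv _ := rfl
  right_inv _ := rfl

theorem exists_norm_H_le : ∃ C : ℝ, 0 < C ∧ ∀ φ : B.H,
    ‖φ‖ ^ 2 ≤ C * (φ.slope ^ 2 + φ.tip ^ 2 + ‖φ.field‖ ^ 2) := by
  obtain ⟨m, C, hm, hC, h⟩ := weighted_bounds B.L_pos B.μ_smooth.continuousOn B.μ_pos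
  have hJ := B.J_pos
  have hM := B.M_pos
  refine ⟨B.J + B.M + C, by positivity, fun φ => ?_⟩
  rw [norm_H_sq]
  have := (h φ.field).2
  nlinarith [mul_nonneg hJ.le (sq_nonneg φ.tip), mul_nonneg hJ.le (sq_nonneg ‖φ.field‖),
    mul_nonneg hM.le (sq_nonneg φ.slope), mul_nonneg hM.le (sq_nonneg ‖φ.field‖),
    mul_nonneg hC.le (sq_nonneg φ.slope), mul_nonneg hC.le (sq_nonneg φ.tip)]

/-- The identity is a linear homeomorphism from the product with its maximum norm. One bound sums
three squares, whence `3 * C`; the other keeps a single summand of `‖φ‖ ^ 2` for each component. -/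
instance : CompleteSpace B.H := by
  obtain ⟨C, hC, hle⟩ := B.exists_norm_H_le
  obtain ⟨m, C', hm, hC', h⟩ := weighted_bounds B.L_pos B.μ_smooth.continuousOn B.μ_pos
  have hJ := B.J_pos
  have hM := B.M_pos
  let e : (ℝ × ℝ × L2 B.L) ≃L[ℝ] B.H := B.prodEquivH.toContinuousLinearEquivOfBounds
    (√(3 * C)) (max √B.J⁻¹ (max √B.M⁻¹ √m⁻¹))
    (fun x => by
      refine le_of_sq_le_sq ?_ (by positivity)
      refine (hle _).trans ?_
      rw [mul_pow, Real.sq_sqrt (by positivity)]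
      have h1 : x.1 ^ 2 ≤ ‖x‖ ^ 2 := by
        rw [← sq_abs]; exact pow_le_pow_left₀ (abs_nonneg _) (norm_fst_le x) 2
      have h2 : x.2.1 ^ 2 ≤ ‖x‖ ^ 2 := by
        rw [← sq_abs]
        exact pow_le_pow_left₀ (abs_nonneg _) ((norm_fst_le x.2).trans (norm_snd_le x)) 2
      have h3 : ‖x.2.2‖ ^ 2 ≤ ‖x‖ ^ 2 :=
        pow_le_pow_left₀ (norm_nonneg _) ((norm_snd_le x.2).trans (norm_snd_le x)) 2
      change C * (x.1 ^ 2 + x.2.1 ^ 2 + ‖x.2.2‖ ^ 2) ≤ 3 * C * ‖x‖ ^ 2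
      nlinarith)
    (fun φ => by
      have hφ := B.norm_H_sq φ
      have h1 := mul_nonneg hJ.le (sq_nonneg φ.slope)
      have h2 := mul_nonneg hM.le (sq_nonneg φ.tip)
      have h3 := (h φ.field).1
      have h4 := mul_nonneg hm.le (sq_nonneg ‖φ.field‖)
      have hn := norm_nonneg φ
      change max |φ.slope| (max |φ.tip| ‖φ.field‖) ≤ _
      refine max_le ?_ (max_le ?_ ?_)
      · refine (le_sqrt_inv_mul hJ hn (by rw [sq_abs]; linarith)).trans ?_
        exact mul_le_mul_of_nonneg_right (le_max_left _ _) hn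
      · refine (le_sqrt_inv_mul hM hn (by rw [sq_abs]; linarith)).trans ?_
        exact mul_le_mul_of_nonneg_right ((le_max_left _ _).trans (le_max_right _ _)) hn
      · refine (le_sqrt_inv_mul hm hn (by linarith)).trans ?_
        exact mul_le_mul_of_nonneg_right ((le_max_right _ _).trans (le_max_right _ _)) hn)
  exact (completeSpace_congr (e := e.toEquiv) e.isUniformEmbedding).1 inferInstance

/-- The element of `H` given by the twofold primitive of `g`. -/
noncomputable def doublePrimitive (g : L2 B.L) : B.H :=
  (∫ t in 0..B.L, g t, ∫ t in 0..B.L, L2.primitive B.L_pos g t,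
    L2.primitive B.L_pos (L2.primitive B.L_pos g))

theorem isHat_doublePrimitive (g : L2 B.L) :
    B.IsHat (B.doublePrimitive g) (L2.primitive B.L_pos g) g where
  deriv₁ := L2.hasWeakDerivOn_primitive B.L_pos _
  deriv₂ := L2.hasWeakDerivOn_primitive B.L_pos _
  clamped := by
    have := L2.hasTrace_primitive B.L_pos (L2.primitive B.L_pos g) 0
    rwa [intervalIntegral.integral_same] at this
  clamped' := by simpa using L2.hasTrace_primitive B.L_pos g 0
  slope_eq := L2.hasTrace_primitive B.L_pos g B.L
  tip_eq := L2.hasTrace_primitive B.L_pos (L2.primitive B.L_pos g) B.L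

/-- The second derivative as a linear map on `V`. -/
noncomputable def dxxₗ : B.V →ₗ[ℝ] L2 B.L where
  toFun v := v.dxx
  map_add' := V.dxx_add
  map_smul' := V.dxx_smul

theorem dxxₗ_injective : Function.Injective B.dxxₗ :=
  (injective_iff_map_eq_zero _).2 fun _ h => V.eq_zero_of_dxx h

theorem exists_toH_eq_doublePrimitive (g : L2 B.L) :
    ∃ v : B.V, v.dxx = g ∧ v.toH = B.doublePrimitive g := by
  have h := B.isHat_doublePrimitive g
  let v : B.V := (⟨B.doublePrimitive g, _, _, h⟩ : B.subV)
  exact ⟨v, V.dxx_eq (w := v) h, rfl⟩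

/-- The clamped conditions make an element of `V` unique given its second derivative, and the double
primitive is one with the right derivative. -/
theorem toH_eq_doublePrimitive (v : B.V) : v.toH = B.doublePrimitive v.dxx := by
  obtain ⟨w, h1, h2⟩ := B.exists_toH_eq_doublePrimitive v.dxx
  rwa [B.dxxₗ_injective h1] at h2

/-- Completeness is transported from `L²(0,L)` along `w ↦ w_xx`; the bounds on `Λ` make this
bijection bicontinuous. -/
instance : CompleteSpace B.V := by
  obtain ⟨m, C, hm, hC, h⟩ := weighted_bounds B.L_pos B.Λ_smooth.continuousOn B.Λ_pos
  let e₀ : B.V ≃ₗ[ℝ] L2 B.L := LinearEquiv.ofBijective B.dxxₗ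
    ⟨B.dxxₗ_injective, fun g => (B.exists_toH_eq_doublePrimitive g).imp fun _ h => h.1⟩
  let e : B.V ≃L[ℝ] L2 B.L := e₀.toContinuousLinearEquivOfBounds (√m⁻¹) (√C)
    (fun v => le_sqrt_inv_mul hm (norm_nonneg v) (by
      rw [norm_V_sq]; exact (h v.dxx).1))
    (fun g => by
      obtain ⟨v, rfl⟩ := e₀.surjective g
      rw [e₀.symm_apply_apply]
      refine le_of_sq_le_sq ?_ (by positivity)
      rw [mul_pow, Real.sq_sqrt hC.le, norm_V_sq]
      exact (h v.dxx).2)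
  exact (completeSpace_congr (e := e.toEquiv) e.isUniformEmbedding).2 inferInstance

theorem exists_norm_toH_le : ∃ C : ℝ, ∀ v : B.V, ‖v.toH‖ ≤ C * ‖v‖ := by
  obtain ⟨C, hC, hle⟩ := B.exists_norm_H_le
  obtain ⟨m, C', hm, -, h⟩ := weighted_bounds B.L_pos B.Λ_smooth.continuousOn B.Λ_pos
  have hL := B.L_pos
  have hLm : B.L ∈ Icc 0 B.L := right_mem_Icc.2 hL.le
  -- The three summands bound the slope, the tip and the field: a primitive has squared norm at most
  -- `L² ‖g‖²`, and evaluating a primitive at `L` costs a factor `L`.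
  have key : ∀ g : L2 B.L, ‖B.doublePrimitive g‖ ^ 2
      ≤ C * (B.L + B.L * B.L ^ 2 + B.L ^ 2 * B.L ^ 2) * ‖g‖ ^ 2 := fun g => by
    have hsq : √B.L ^ 2 = B.L := Real.sq_sqrt hL.le
    have h1 : (∫ t in 0..B.L, g t) ^ 2 ≤ (√B.L * ‖g‖) ^ 2 := by
      rw [← sq_abs]
      exact pow_le_pow_left₀ (abs_nonneg _) (L2.norm_intervalIntegral_le hL g hLm) 2
    have h0 : ‖L2.primitive hL g‖ ^ 2 ≤ (√B.L * (√B.L * ‖g‖)) ^ 2 :=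
      pow_le_pow_left₀ (norm_nonneg _) (L2.norm_primitive_le hL g) 2
    have h2 : (∫ t in 0..B.L, L2.primitive hL g t) ^ 2
        ≤ (√B.L * ‖L2.primitive hL g‖) ^ 2 := by
      rw [← sq_abs]
      exact pow_le_pow_left₀ (abs_nonneg _) (L2.norm_intervalIntegral_le hL _ hLm) 2
    have h3 : ‖L2.primitive hL (L2.primitive hL g)‖ ^ 2
        ≤ (√B.L * (√B.L * ‖L2.primitive hL g‖)) ^ 2 :=
      pow_le_pow_left₀ (norm_nonneg _) (L2.norm_primitive_le hL _) 2
    simp only [mul_pow, hsq] at h0 h1 h2 h3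
    have h2' := h2.trans (mul_le_mul_of_nonneg_left h0 hL.le)
    have h3' := h3.trans (mul_le_mul_of_nonneg_left (mul_le_mul_of_nonneg_left h0 hL.le) hL.le)
    refine (hle _).trans ?_
    rw [mul_assoc]
    refine mul_le_mul_of_nonneg_left ?_ hC.le
    refine (add_le_add (add_le_add h1 h2') h3').trans (le_of_eq ?_)
    ring
  set D := C * (B.L + B.L * B.L ^ 2 + B.L ^ 2 * B.L ^ 2) with hD
  have hD0 : 0 ≤ D := by positivity
  refine ⟨√(D / m), fun v => le_of_sq_le_sq ?_ (by positivity)⟩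
  rw [toH_eq_doublePrimitive, mul_pow, Real.sq_sqrt (by positivity), norm_V_sq, div_mul_eq_mul_div,
    le_div_iff₀ hm]
  nlinarith [key v.dxx, (h v.dxx).1]

/-- The inclusion of `V` into `H` as a continuous linear map. -/
noncomputable def inclusion : B.V →L[ℝ] B.H :=
  LinearMap.mkContinuousOfExistsBound
    { toFun := V.toH
      map_add' := fun _ _ => rfl
      map_smul' := fun _ _ => rfl } B.exists_norm_toH_le

theorem inclusion_apply (v : B.V) : B.inclusion v = v.toH := rfl

end Beam

/-! ### Mollification in `L²(ℝ; E)` -/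

section Mollification

open Filter Topology
open scoped Convolution ENNReal

variable {E : Type*} [NormedAddCommGroup E]

theorem tendsto_eLpNorm_translate_sub {g : ℝ → E} (hg : MemLp g 2 volume) :
    Tendsto (fun s => eLpNorm (fun t => g (t - s) - g t) 2 volume) (𝓝 0) (𝓝 0) := by
  -- Translation by `s` depends continuously on `s` in the compact-open topology, and composition
  -- with measure preserving maps is continuous in `L²`.
  let τ : C(ℝ, C(ℝ, ℝ)) := ContinuousMap.curry ⟨fun p : ℝ × ℝ => p.2 - p.1, by fun_prop⟩
  have hτ : ∀ s, MeasurePreserving (τ s) volume volume := fun s =>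
    measurePreserving_sub_right volume s
  have hc : Continuous fun s => Lp.compMeasurePreserving (τ s) (hτ s) hg.toLp :=
    (continuous_const (y := hg.toLp)).compMeasurePreservingLp τ.continuous hτ (by norm_num)
  have h := tendsto_iff_edist_tendsto_0.1 (hc.tendsto 0)
  refine h.congr fun s => ?_
  rw [Lp.toLp_compMeasurePreserving hg (hτ s), Lp.toLp_compMeasurePreserving hg (hτ 0),
    Lp.edist_toLp_toLp]
  refine eLpNorm_congr_ae (Eventually.of_forall fun t => ?_)
  simp [τ]

/-- Jensen's inequality for the square, from the monotonicity of `L^p` norms under a probability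
measure. -/
theorem enorm_integral_sq_le {α : Type*} [MeasurableSpace α] [NormedSpace ℝ E]
    (ν : Measure α) [IsProbabilityMeasure ν] {k : α → E} (hk : AEStronglyMeasurable k ν) :
    ‖∫ s, k s ∂ν‖ₑ ^ 2 ≤ ∫⁻ s, ‖k s‖ₑ ^ 2 ∂ν := by
  have h1 : ‖∫ s, k s ∂ν‖ₑ ≤ eLpNorm k 2 ν := by
    refine (enorm_integral_le_lintegral_enorm k).trans ?_
    rw [← eLpNorm_one_eq_lintegral_enorm]
    exact eLpNorm_le_eLpNorm_of_exponent_le (by norm_num) hk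
  refine (pow_le_pow_left₀ zero_le h1 2).trans (le_of_eq ?_)
  have := eLpNorm_nnreal_pow_eq_lintegral (f := k) (μ := ν) (p := 2) (by norm_num)
  simpa using this

theorem eLpNorm_two_sq {α : Type*} [MeasurableSpace α] (ν : Measure α) (k : α → E) :
    eLpNorm k 2 ν ^ 2 = ∫⁻ s, ‖k s‖ₑ ^ 2 ∂ν := by
  have := eLpNorm_nnreal_pow_eq_lintegral (f := k) (μ := ν) (p := 2) (by norm_num)
  simpa using this

variable [NormedSpace ℝ E] [CompleteSpace E]

/-- The error of mollification is the average of `g(· - s) - g` over the probability measure with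
density the kernel. Jensen's inequality at each `t` and Tonelli bound its norm by the largest
translation error on the support. Strong measurability of `g` makes the integrand jointly
measurable. -/
theorem eLpNorm_mollify_sub_le {c : ℝ} (φ : ContDiffBump c) {g : ℝ → E}
    (hgm : StronglyMeasurable g) (hg : MemLp g 2 volume) {η : ℝ≥0∞}
    (h : ∀ s ∈ Metric.ball c φ.rOut, eLpNorm (fun t => g (t - s) - g t) 2 volume ≤ η) :
    eLpNorm (fun t => (φ.normed volume ⋆[ContinuousLinearMap.lsmul ℝ ℝ] g) t - g t) 2 volume
      ≤ η := by
  set ρ : ℝ → ℝ := φ.normed volume with hρ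
  have hρ0 : ∀ s, 0 ≤ ρ s := fun s => φ.nonneg_normed s
  have hρc : Continuous ρ := φ.continuous_normed
  set ν : Measure ℝ := volume.withDensity fun s => ENNReal.ofReal (ρ s) with hν
  have hνp : IsProbabilityMeasure ν := by
    refine ⟨?_⟩
    rw [hν, withDensity_apply _ MeasurableSet.univ, Measure.restrict_univ,
      ← ofReal_integral_eq_lintegral_ofReal φ.integrable_normed (Eventually.of_forall hρ0),
      φ.integral_normed, ENNReal.ofReal_one]
  have hint : ∀ k : ℝ → E, ∫ s, k s ∂ν = ∫ s, ρ s • k s := fun k => by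
    rw [hν, integral_withDensity_eq_integral_toReal_smul (by fun_prop)
      (Eventually.of_forall fun _ => ENNReal.ofReal_lt_top)]
    simp only [ENNReal.toReal_ofReal (hρ0 _)]
  have hgl : LocallyIntegrable g volume := hg.locallyIntegrable (by norm_num)
  have hconv : ∀ t, (ρ ⋆[ContinuousLinearMap.lsmul ℝ ℝ] g) t - g t
      = ∫ s, (g (t - s) - g t) ∂ν := fun t => by
    rw [hint]
    have h1 : Integrable (fun s => ρ s • g (t - s)) volume :=
      φ.hasCompactSupport_normed.convolutionExists_left (ContinuousLinearMap.lsmul ℝ ℝ) hρc hgl t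
    have h2 : Integrable (fun s => ρ s • g t) volume := φ.integrable_normed.smul_const _
    simp only [smul_sub]
    rw [integral_sub h1 h2, integral_smul_const, φ.integral_normed, one_smul]
    rfl
  have hjm : StronglyMeasurable fun p : ℝ × ℝ => g (p.1 - p.2) - g p.1 :=
    (hgm.comp_measurable (measurable_fst.sub measurable_snd)).sub
      (hgm.comp_measurable measurable_fst)
  rw [← ENNReal.pow_le_pow_left_iff (n := 2) (by norm_num), eLpNorm_two_sq]
  calc ∫⁻ t, ‖(ρ ⋆[ContinuousLinearMap.lsmul ℝ ℝ] g) t - g t‖ₑ ^ 2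
      ≤ ∫⁻ t, ∫⁻ s, ‖g (t - s) - g t‖ₑ ^ 2 ∂ν := by
        refine lintegral_mono fun t => ?_
        rw [hconv]
        exact enorm_integral_sq_le ν
          (hjm.comp_measurable (measurable_const.prodMk measurable_id)).aestronglyMeasurable
    _ = ∫⁻ s, (∫⁻ t, ‖g (t - s) - g t‖ₑ ^ 2) ∂ν := by
        exact lintegral_lintegral_swap (hjm.enorm.pow_const 2).aemeasurable
    _ ≤ ∫⁻ _, η ^ 2 ∂ν := by
        refine lintegral_mono_ae ?_
        rw [hν, ae_withDensity_iff (by fun_prop)]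
        refine Eventually.of_forall fun s hs => ?_
        rw [← eLpNorm_two_sq]
        refine pow_le_pow_left₀ zero_le (h s ?_) 2
        rw [← φ.support_normed_eq (μ := volume)]
        intro h0
        exact hs (by rw [hρ, h0, ENNReal.ofReal_zero])
    _ = η ^ 2 := by simp

/-- The bumps need not be centred at `0`: it is enough that centres and radii tend to `0`, so that
only small translations occur. This leaves room for one-sided kernels. -/
theorem tendsto_eLpNorm_mollify_sub {c : ℕ → ℝ} (φ : ∀ n, ContDiffBump (c n))
    (hc : Tendsto c atTop (𝓝 0)) (hr : Tendsto (fun n => (φ n).rOut) atTop (𝓝 0))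
    {g : ℝ → E} (hg : MemLp g 2 volume) :
    Tendsto (fun n => eLpNorm
      ((φ n).normed volume ⋆[ContinuousLinearMap.lsmul ℝ ℝ] g - g) 2 volume) atTop (𝓝 0) := by
  have hmk := hg.aestronglyMeasurable.ae_eq_mk
  have hg' : MemLp (hg.aestronglyMeasurable.mk g) 2 volume := (memLp_congr_ae hmk).1 hg
  have hτ := tendsto_eLpNorm_translate_sub hg'
  rw [ENNReal.tendsto_nhds_zero] at hτ ⊢
  intro η hη
  obtain ⟨δ, hδ, hball⟩ := Metric.eventually_nhds_iff.1 (hτ η hη)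
  have h1 : ∀ᶠ n in atTop, |c n| < δ / 2 := by
    simpa using (tendsto_order.1 (hc.abs)).2 (δ / 2) (by simpa using half_pos hδ)
  filter_upwards [h1, (tendsto_order.1 hr).2 (δ / 2) (half_pos hδ)] with n hn1 hn2
  have := eLpNorm_mollify_sub_le (φ n) hg.aestronglyMeasurable.stronglyMeasurable_mk hg'
    (η := η) fun s hs => hball (by
      rw [Metric.mem_ball, Real.dist_eq] at hs
      rw [Real.dist_eq, sub_zero]
      calc |s| = |s - c n + c n| := by rw [sub_add_cancel]
        _ ≤ |s - c n| + |c n| := abs_add_le _ _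
        _ < δ := by linarith)
  refine le_trans (le_of_eq (eLpNorm_congr_ae ?_)) this
  filter_upwards [hmk] with t ht
  rw [Pi.sub_apply, convolution_congr _ (EventuallyEq.refl _ _) hmk, ← ht]

end Mollification

section Abstract

open Filter Topology
open scoped Convolution ENNReal

/-! ### The energy estimate -/

variable {V H : Type*} [NormedAddCommGroup V] [InnerProductSpace ℝ V]
  [NormedAddCommGroup H] [InnerProductSpace ℝ H]

/-- The energy of a strong solution of `ü + u = F` in `V'` is bounded by its mean. -/
theorem energy_le {ι : V →L[ℝ] H} {a b : ℝ} (hab : a < b) {U U' : ℝ → V} {W W' F : ℝ → H}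
    (hU : ∀ t ∈ Icc a b, HasDerivAt U (U' t) t) (hW : ∀ t ∈ Icc a b, HasDerivAt W (W' t) t)
    (hF : ContinuousOn F (Icc a b)) (hι : ∀ t ∈ Icc a b, ι (U' t) = W t)
    (heq : ∀ t ∈ Icc a b, ∀ w, ⟪W' t, ι w⟫ = ⟪F t, ι w⟫ - ⟪U t, w⟫) :
    ∀ t ∈ Icc a b, ‖U t‖ ^ 2 + ‖W t‖ ^ 2
      ≤ ((b - a)⁻¹ + 1) * ∫ s in a..b, (‖U s‖ ^ 2 + ‖W s‖ ^ 2 + ‖F s‖ ^ 2) := by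
  intro t ht
  have hUc : ContinuousOn U (Icc a b) := fun s hs => (hU s hs).continuousAt.continuousWithinAt
  have hWc : ContinuousOn W (Icc a b) := fun s hs => (hW s hs).continuousAt.continuousWithinAt
  set e : ℝ → ℝ := fun s => ‖U s‖ ^ 2 + ‖W s‖ ^ 2 with he
  set G : ℝ → ℝ := fun s => ‖U s‖ ^ 2 + ‖W s‖ ^ 2 + ‖F s‖ ^ 2 with hG
  have hec : ContinuousOn e (Icc a b) := by fun_prop
  have hGc : ContinuousOn G (Icc a b) := by fun_prop
  have hGi : IntervalIntegrable G volume a b := hGc.intervalIntegrable_of_Icc hab.le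
  -- Energy identity: with the test vector `w = U' s`, for which `ι w = W s`, the two terms
  -- containing `⟪U, U'⟫` cancel.
  have hed : ∀ s ∈ Icc a b, HasDerivAt e (2 * ⟪F s, W s⟫) s := fun s hs => by
    have h1 := (hU s hs).norm_sq.add (hW s hs).norm_sq
    have h2 := heq s hs (U' s)
    rw [hι s hs] at h2
    refine h1.congr_deriv ?_
    linarith [real_inner_comm (U s) (U' s), real_inner_comm (W s) (W' s)]
  -- No initial value is available, so the estimate starts from a time of least energy, where the
  -- energy is at most its mean.
  obtain ⟨s, hs, hmin⟩ := isCompact_Icc.exists_isMinOn (nonempty_Icc.2 hab.le) hec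
  have hmean : e s ≤ (b - a)⁻¹ * ∫ r in a..b, G r := by
    have h1 : ∫ _ in a..b, e s ≤ ∫ r in a..b, G r := by
      refine intervalIntegral.integral_mono_on hab.le (by simp) hGi fun r hr => ?_
      exact (hmin hr).trans (le_add_of_nonneg_right (sq_nonneg _))
    rw [intervalIntegral.integral_const, smul_eq_mul] at h1
    rwa [le_inv_mul_iff₀ (by linarith)]
  have hsub : uIcc s t ⊆ Icc a b := by
    rw [← uIcc_of_le hab.le]
    exact uIcc_subset_uIcc (Icc_subset_uIcc hs) (Icc_subset_uIcc ht)
  have hdi : IntervalIntegrable (fun r => 2 * ⟪F r, W r⟫) volume s t := by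
    refine ContinuousOn.intervalIntegrable (ContinuousOn.mono ?_ hsub)
    exact continuousOn_const.mul (hF.inner hWc)
  have hftc := intervalIntegral.integral_eq_sub_of_hasDerivAt (fun r hr => hed r (hsub hr)) hdi
  -- Young's inequality: `2 |⟪F, W⟫| ≤ ‖F‖² + ‖W‖²`.
  have hbd : |e t - e s| ≤ ∫ r in a..b, G r := by
    rw [← hftc]
    have hG0 : ∀ r, 0 ≤ G r := fun r => by positivity
    calc |∫ r in s..t, 2 * ⟪F r, W r⟫| ≤ |∫ r in s..t, G r| := by
          have := intervalIntegral.norm_integral_le_abs_of_norm_le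
            (f := fun r => 2 * ⟪F r, W r⟫) (g := G) (a := s) (b := t) (μ := volume) ?_
            ((hGc.mono hsub).intervalIntegrable)
          · simpa only [Real.norm_eq_abs] using this
          · refine Eventually.of_forall fun r => ?_
            rw [norm_mul, Real.norm_two]
            have := norm_inner_le_norm (𝕜 := ℝ) (F r) (W r)
            nlinarith [sq_nonneg (‖F r‖ - ‖W r‖), sq_nonneg ‖U r‖]
      _ ≤ |∫ r in a..b, G r| := by
          refine intervalIntegral.abs_integral_mono_interval ?_ (ae_of_all _ hG0) hGi
          rw [uIoc_of_le hab.le, uIoc]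
          exact Ioc_subset_Ioc (le_min hs.1 ht.1) (max_le hs.2 ht.2)
      _ = ∫ r in a..b, G r :=
          abs_of_nonneg (intervalIntegral.integral_nonneg hab.le fun r _ => hG0 r)
  have := (abs_le.1 hbd).2
  change e t ≤ _
  linarith

theorem intervalIntegral_norm_sq_le {E : Type*} [NormedAddCommGroup E] {Z : ℝ → E}
    (hZ : Continuous Z) {a b r : ℝ} (hab : a ≤ b) (hr : 0 ≤ r)
    (h : eLpNorm Z 2 volume ≤ ENNReal.ofReal r) : ∫ s in a..b, ‖Z s‖ ^ 2 ≤ r ^ 2 := by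
  rw [intervalIntegral.integral_of_le hab,
    integral_eq_lintegral_of_nonneg_ae (Eventually.of_forall fun _ => sq_nonneg _)
      (by fun_prop)]
  refine ENNReal.toReal_le_of_le_ofReal (sq_nonneg r) ?_
  rw [ENNReal.ofReal_pow hr]
  refine le_trans (le_trans ?_ (setLIntegral_le_lintegral (μ := volume) (Ioc a b) fun s => ‖Z s‖ₑ ^ 2)) ?_
  · refine lintegral_mono fun s => le_of_eq ?_
    rw [ENNReal.ofReal_pow (norm_nonneg _), ofReal_norm]
  · rw [← eLpNorm_two_sq]
    exact pow_le_pow_left₀ zero_le h 2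

theorem intervalIntegral_norm_sub_sq_le {E : Type*} [NormedAddCommGroup E] {X Y k : ℝ → E}
    (hX : Continuous X) (hY : Continuous Y) (hk : AEStronglyMeasurable k volume) {a b r : ℝ}
    (hab : a ≤ b) (hr : 0 ≤ r) (hXk : eLpNorm (X - k) 2 volume ≤ ENNReal.ofReal r)
    (hYk : eLpNorm (Y - k) 2 volume ≤ ENNReal.ofReal r) :
    ∫ s in a..b, ‖X s - Y s‖ ^ 2 ≤ (r + r) ^ 2 := by
  refine intervalIntegral_norm_sq_le (Z := X - Y) (hX.sub hY) hab (by linarith) ?_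
  rw [← sub_sub_sub_cancel_right X Y k, ENNReal.ofReal_add hr hr]
  exact (eLpNorm_sub_le (hX.aestronglyMeasurable.sub hk) (hY.aestronglyMeasurable.sub hk)
    (by norm_num)).trans (add_le_add hXk hYk)

/-! ### Mollification of functions on `(0, T)` -/

/-- The support condition says that the convolution at time `t` samples only a compact part of `(0,
T)`. The extension by zero is then never felt, and the weak equation may be tested with the
reflected kernel. -/
theorem isTestFun_reflect {T t : ℝ} {ρ : ℝ → ℝ} (hρ : ContDiff ℝ ∞ ρ) (hc : HasCompactSupport ρ)
    (hs : tsupport ρ ⊆ Ioo (t - T) t) : IsTestFun 0 T fun s => ρ (t - s) where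
  smooth := hρ.comp (contDiff_const.sub contDiff_id)
  compact := hc.comp_homeomorph (Homeomorph.subLeft t)
  supp := by
    intro s hs'
    have : t - s ∈ tsupport ρ := by
      have h := tsupport_comp_subset_preimage ρ (f := fun s : ℝ => t - s) (by fun_prop)
      exact h hs'
    have := hs this
    exact ⟨by linarith [this.2], by linarith [this.1]⟩

/-- The reflection contributes a minus sign, which cancels the one in the definition of the weak
derivative. -/
theorem HasWeakDerivOn.integral_deriv_mollifier {T t : ℝ} {p q ρ : ℝ → ℝ}
    (h : HasWeakDerivOn 0 T p q) (hρ : ContDiff ℝ ∞ ρ) (hc : HasCompactSupport ρ)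
    (hs : tsupport ρ ⊆ Ioo (t - T) t) :
    ∫ s in Ioo 0 T, deriv ρ (t - s) * p s = ∫ s in Ioo 0 T, ρ (t - s) * q s := by
  have := h _ (isTestFun_reflect hρ hc hs)
  simp only [deriv_comp_const_sub, mul_neg, integral_neg, neg_inj] at this
  simpa only [mul_comm] using this

variable {E : Type*} [NormedAddCommGroup E]

theorem memLp_indicator_Ioo {T : ℝ} {k : ℝ → E} (hk : MemLp k 2 (timeMeasure T)) :
    MemLp ((Ioo 0 T).indicator k) 2 volume :=
  (memLp_indicator_iff_restrict measurableSet_Ioo).2 hk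

theorem locallyIntegrable_indicator_Ioo {T : ℝ} {k : ℝ → E} (hk : MemLp k 2 (timeMeasure T)) :
    LocallyIntegrable ((Ioo 0 T).indicator k) volume :=
  (memLp_indicator_Ioo hk).locallyIntegrable (by norm_num)

/-- The uniform limit is continuous, and it is identified with the `L²` limit along a subsequence
converging almost everywhere. -/
theorem exists_continuousOn_of_uniformCauchySeqOn [CompleteSpace E] {U : ℕ → ℝ → E} {k : ℝ → E}
    {a b : ℝ} (hU : ∀ n, Continuous (U n)) (hk : AEStronglyMeasurable k volume)
    (hc : UniformCauchySeqOn U atTop (Icc a b))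
    (hlim : Tendsto (fun n => eLpNorm (U n - k) 2 volume) atTop (𝓝 0)) :
    ∃ g : ℝ → E, ContinuousOn g (Icc a b) ∧ ∀ᵐ t, t ∈ Icc a b → k t = g t := by
  have hex : ∀ t, ∃ x, t ∈ Icc a b → Tendsto (fun n => U n t) atTop (𝓝 x) := fun t => by
    by_cases ht : t ∈ Icc a b
    · obtain ⟨x, hx⟩ := cauchySeq_tendsto_of_complete (hc.cauchySeq ht)
      exact ⟨x, fun _ => hx⟩
    · exact ⟨0, fun h => absurd h ht⟩
  choose g hg using hex
  have hunif := hc.tendstoUniformlyOn_of_tendsto hg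
  refine ⟨g, hunif.continuousOn (Frequently.of_forall fun n => (hU n).continuousOn), ?_⟩
  obtain ⟨ns, hns, hae⟩ := (tendstoInMeasure_of_tendsto_eLpNorm (by norm_num)
    (fun n => (hU n).aestronglyMeasurable) hk hlim).exists_seq_tendsto_ae
  filter_upwards [hae] with t ht hmem
  exact tendsto_nhds_unique ht ((hg t hmem).comp hns.tendsto_atTop)

variable [NormedSpace ℝ E]

/-- The convolution of `ρ` with the extension of `k` by zero. -/
noncomputable def mollify (T : ℝ) (ρ : ℝ → ℝ) (k : ℝ → E) : ℝ → E :=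
  ρ ⋆[ContinuousLinearMap.lsmul ℝ ℝ] (Ioo 0 T).indicator k

theorem mollify_apply (T : ℝ) (ρ : ℝ → ℝ) (k : ℝ → E) (t : ℝ) :
    mollify T ρ k t = ∫ s in Ioo 0 T, ρ (t - s) • k s := by
  rw [mollify, convolution_lsmul_swap, ← integral_indicator measurableSet_Ioo]
  congr 1; ext s
  by_cases hs : s ∈ Ioo 0 T <;> simp [hs]

theorem continuous_mollify {T : ℝ} {ρ : ℝ → ℝ} {k : ℝ → E} (hρ : Continuous ρ)
    (hc : HasCompactSupport ρ) (hk : MemLp k 2 (timeMeasure T)) :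
    Continuous (mollify T ρ k) :=
  hc.continuous_convolution_left _ hρ (locallyIntegrable_indicator_Ioo hk)

theorem hasDerivAt_mollify [CompleteSpace E] {T : ℝ} {ρ : ℝ → ℝ} {k : ℝ → E}
    (hρ : ContDiff ℝ ∞ ρ) (hc : HasCompactSupport ρ) (hk : MemLp k 2 (timeMeasure T)) (t : ℝ) :
    HasDerivAt (mollify T ρ k) (mollify T (deriv ρ) k t) t :=
  hc.hasDerivAt_convolution_left _ (hρ.of_le (by norm_cast))
    (locallyIntegrable_indicator_Ioo hk) t

theorem clm_mollify [CompleteSpace E] {T : ℝ} {ρ : ℝ → ℝ} {k : ℝ → E} (hρ : Continuous ρ)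
    (hc : HasCompactSupport ρ) (hk : MemLp k 2 (timeMeasure T)) (ℓ : E →L[ℝ] ℝ) (t : ℝ) :
    ℓ (mollify T ρ k t) = ∫ s in Ioo 0 T, ρ (t - s) * ℓ (k s) := by
  have hi : Integrable (fun s => ρ (t - s) • k s) (timeMeasure T) := by
    obtain ⟨C, hC⟩ := hc.exists_bound_of_continuous hρ
    exact (hk.integrable (by norm_num)).bdd_smul (φ := fun s => ρ (t - s)) C
      (hρ.comp (continuous_const.sub continuous_id)).aestronglyMeasurable
      (Eventually.of_forall fun s => hC _)
  rw [mollify_apply, ← ℓ.integral_comp_comm hi]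
  simp only [map_smul, smul_eq_mul]

/-! ### The mollified equation. -/

section Equation

variable [CompleteSpace V] [CompleteSpace H] {ι : V →L[ℝ] H} {T t : ℝ} {u : ℝ → V}
  {ut f : ℝ → H} {ρ : ℝ → ℝ}

theorem map_mollify_deriv (hu : MemLp u 2 (timeMeasure T)) (hut : MemLp ut 2 (timeMeasure T))
    (h : ∀ x, HasWeakDerivOn 0 T (fun t => ⟪ι (u t), x⟫) (fun t => ⟪ut t, x⟫))
    (hρ : ContDiff ℝ ∞ ρ) (hc : HasCompactSupport ρ) (hs : tsupport ρ ⊆ Ioo (t - T) t) :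
    ι (mollify T (deriv ρ) u t) = mollify T ρ ut t := by
  refine ext_inner_left ℝ fun x => ?_
  have h1 := clm_mollify (hρ.continuous_deriv (by simp)) hc.deriv hu
    ((innerSL ℝ x).comp ι) t
  have h2 := clm_mollify hρ.continuous hc hut (innerSL ℝ x) t
  simp only [ContinuousLinearMap.comp_apply, innerSL_apply_apply] at h1 h2
  rw [h1, h2]
  have := (h x).integral_deriv_mollifier hρ hc hs
  simpa only [real_inner_comm x] using this

/-- Since the derivative falls on the kernel, the mollified second time derivative lies in `H`
rather than only in `V'`. Hence the equation can be paired with vectors of `V` that depend on time.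
-/
theorem inner_mollify_deriv (hu : MemLp u 2 (timeMeasure T)) (hut : MemLp ut 2 (timeMeasure T))
    (hf : MemLp f 2 (timeMeasure T))
    (h : ∀ w, HasWeakDerivOn 0 T (fun t => ⟪ut t, ι w⟫) (fun t => ⟪f t, ι w⟫ - ⟪u t, w⟫))
    (hρ : ContDiff ℝ ∞ ρ) (hc : HasCompactSupport ρ) (hs : tsupport ρ ⊆ Ioo (t - T) t) (w : V) :
    ⟪mollify T (deriv ρ) ut t, ι w⟫ = ⟪mollify T ρ f t, ι w⟫ - ⟪mollify T ρ u t, w⟫ := by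
  have h1 := clm_mollify (hρ.continuous_deriv (by simp)) hc.deriv hut (innerSL ℝ (ι w)) t
  have h2 := clm_mollify hρ.continuous hc hf (innerSL ℝ (ι w)) t
  have h3 := clm_mollify hρ.continuous hc hu (innerSL ℝ w) t
  simp only [innerSL_apply_apply] at h1 h2 h3
  rw [real_inner_comm, h1, real_inner_comm, h2, real_inner_comm w, h3, ← integral_sub]
  · have := (h w).integral_deriv_mollifier hρ hc hs
    simpa only [real_inner_comm, mul_sub] using this
  all_goals
    obtain ⟨C, hC⟩ := hc.exists_bound_of_continuous hρ.continuous
    refine Integrable.bdd_mul (c := C) ?_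
      (hρ.continuous.comp (continuous_const.sub continuous_id)).aestronglyMeasurable
      (Eventually.of_forall fun s => hC _)
  · exact (innerSL ℝ (ι w)).integrable_comp (hf.integrable (by norm_num))
  · exact (innerSL ℝ w).integrable_comp (hu.integrable (by norm_num))

end Equation

/-- One bump inside `(p, q)` is contracted towards `0`. As `0 ∈ [p, q]`, the contracted supports
stay in `(p, q)`, even when `0` is an endpoint. -/
theorem exists_contDiffBump_seq {p q : ℝ} (hp : p ≤ 0) (hq : 0 ≤ q) (hpq : p < q) :
    ∃ (c : ℕ → ℝ) (φ : ∀ n, ContDiffBump (c n)), Tendsto c atTop (𝓝 0) ∧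
      Tendsto (fun n => (φ n).rOut) atTop (𝓝 0) ∧
      ∀ n, Metric.closedBall (c n) (φ n).rOut ⊆ Ioo p q := by
  have hd : 0 < q - p := by linarith
  have ht : ∀ r : ℝ, Tendsto (fun n : ℕ => r * (1 / ((n : ℝ) + 1))) atTop (𝓝 0) := fun r => by
    simpa using tendsto_one_div_add_atTop_nhds_zero_nat.const_mul r
  refine ⟨fun n => (p + q) / 2 * (1 / ((n : ℝ) + 1)), fun n =>
    ⟨(q - p) / 8 * (1 / ((n : ℝ) + 1)), (q - p) / 4 * (1 / ((n : ℝ) + 1)), by positivity, ?_⟩,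
    ht _, ht _, fun n => ?_⟩
  · exact mul_lt_mul_of_pos_right (by linarith) (by positivity)
  · have hn : (0 : ℝ) ≤ n := n.cast_nonneg
    have h1 : 0 < 1 / ((n : ℝ) + 1) := by positivity
    have h2 : 1 / ((n : ℝ) + 1) ≤ 1 := by
      rw [div_le_one (by positivity)]; linarith
    rw [Real.closedBall_eq_Icc]
    refine Icc_subset_Ioo ?_ ?_
    · nlinarith
    · nlinarith

/-! ### Continuity in the energy norm. -/

section Regularity

variable [CompleteSpace V] [CompleteSpace H] {ι : V →L[ℝ] H} {T : ℝ} {u : ℝ → V} {ut f : ℝ → H}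

theorem exists_continuousOn_subinterval {a b : ℝ} (hab : a < b) (ha : 0 ≤ a) (hb : b ≤ T)
    (hba : b - a < T) (hu : MemLp u 2 (timeMeasure T)) (hut : MemLp ut 2 (timeMeasure T))
    (hf : MemLp f 2 (timeMeasure T))
    (h₁ : ∀ x, HasWeakDerivOn 0 T (fun t => ⟪ι (u t), x⟫) (fun t => ⟪ut t, x⟫))
    (h₂ : ∀ w, HasWeakDerivOn 0 T (fun t => ⟪ut t, ι w⟫) (fun t => ⟪f t, ι w⟫ - ⟪u t, w⟫)) :
    ∃ (uc : ℝ → V) (vc : ℝ → H), ContinuousOn uc (Icc a b) ∧ ContinuousOn vc (Icc a b) ∧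
      (∀ᵐ t ∂timeMeasure T, t ∈ Icc a b → u t = uc t) ∧
      ∀ᵐ t ∂timeMeasure T, t ∈ Icc a b → ut t = vc t := by
  -- The interval `(b - T, a)` is contained in `(t - T, t)` for every `t ∈ [a, b]`, so a kernel
  -- supported in it is admissible on all of `[a, b]`. It is nonempty because `b - a < T`.
  obtain ⟨c, φ, hc, hr, hsub⟩ := exists_contDiffBump_seq (p := b - T) (q := a) (by linarith) ha
    (by linarith)
  set ρ : ℕ → ℝ → ℝ := fun n => (φ n).normed volume with hρ
  have hρs : ∀ n, ContDiff ℝ ∞ (ρ n) := fun n => (φ n).contDiff_normed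
  have hρc : ∀ n, HasCompactSupport (ρ n) := fun n => (φ n).hasCompactSupport_normed
  have hρt : ∀ n, ∀ t ∈ Icc a b, tsupport (ρ n) ⊆ Ioo (t - T) t := fun n t ht => by
    rw [hρ, (φ n).tsupport_normed_eq]
    exact (hsub n).trans (Ioo_subset_Ioo (by linarith [ht.2]) ht.1)
  have hlu := tendsto_eLpNorm_mollify_sub φ hc hr (memLp_indicator_Ioo hu)
  have hlv := tendsto_eLpNorm_mollify_sub φ hc hr (memLp_indicator_Ioo hut)
  have hlf := tendsto_eLpNorm_mollify_sub φ hc hr (memLp_indicator_Ioo hf)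
  have hcu : ∀ n, Continuous (mollify T (ρ n) u) := fun n =>
    continuous_mollify (hρs n).continuous (hρc n) hu
  have hcv : ∀ n, Continuous (mollify T (ρ n) ut) := fun n =>
    continuous_mollify (hρs n).continuous (hρc n) hut
  have hcf : ∀ n, Continuous (mollify T (ρ n) f) := fun n =>
    continuous_mollify (hρs n).continuous (hρc n) hf
  set C : ℝ := (b - a)⁻¹ + 1 with hC
  have hC0 : 0 < C := by
    have : 0 < b - a := by linarith
    positivity
  have key : ∀ n m, ∀ t ∈ Icc a b,
      ‖mollify T (ρ n) u t - mollify T (ρ m) u t‖ ^ 2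
        + ‖mollify T (ρ n) ut t - mollify T (ρ m) ut t‖ ^ 2
      ≤ C * ∫ s in a..b, (‖mollify T (ρ n) u s - mollify T (ρ m) u s‖ ^ 2
        + ‖mollify T (ρ n) ut s - mollify T (ρ m) ut s‖ ^ 2
        + ‖mollify T (ρ n) f s - mollify T (ρ m) f s‖ ^ 2) := fun n m =>
    energy_le (ι := ι) hab
      (U' := fun t => mollify T (deriv (ρ n)) u t - mollify T (deriv (ρ m)) u t)
      (W' := fun t => mollify T (deriv (ρ n)) ut t - mollify T (deriv (ρ m)) ut t)
      (fun t _ => (hasDerivAt_mollify (hρs n) (hρc n) hu t).sub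
        (hasDerivAt_mollify (hρs m) (hρc m) hu t))
      (fun t _ => (hasDerivAt_mollify (hρs n) (hρc n) hut t).sub
        (hasDerivAt_mollify (hρs m) (hρc m) hut t))
      ((hcf n).sub (hcf m)).continuousOn
      (fun t ht => by
        rw [map_sub, map_mollify_deriv hu hut h₁ (hρs n) (hρc n) (hρt n t ht),
          map_mollify_deriv hu hut h₁ (hρs m) (hρc m) (hρt m t ht)])
      (fun t ht w => by
        simp only [inner_sub_left]
        rw [inner_mollify_deriv hu hut hf h₂ (hρs n) (hρc n) (hρt n t ht),
          inner_mollify_deriv hu hut hf h₂ (hρs m) (hρc m) (hρt m t ht)]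
        ring)
  have hcau : ∀ ε > 0, ∃ N, ∀ n ≥ N, ∀ m ≥ N, ∀ t ∈ Icc a b,
      ‖mollify T (ρ n) u t - mollify T (ρ m) u t‖ ^ 2
        + ‖mollify T (ρ n) ut t - mollify T (ρ m) ut t‖ ^ 2 < ε ^ 2 := by
    intro ε hε
    -- If all `L²` errors are at most `r`, the energy of the difference is at most `C * 3 * (2 r)² =
    -- 12 C r²`, which is below `ε² = (12 C + 1)² r²`.
    set r : ℝ := ε / (12 * C + 1) with hr
    have hr0 : 0 < r := by positivity
    have hrε : C * (3 * (r + r) ^ 2) < ε ^ 2 := by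
      have h1 : ε = r * (12 * C + 1) := by rw [hr]; field_simp
      rw [h1]
      nlinarith [sq_pos_of_pos hr0, mul_pos hC0 (sq_pos_of_pos hr0),
        mul_pos (mul_pos hC0 hC0) (sq_pos_of_pos hr0)]
    have hr0' : 0 < ENNReal.ofReal r := ENNReal.ofReal_pos.2 hr0
    obtain ⟨N, hN⟩ := eventually_atTop.1 (((ENNReal.tendsto_nhds_zero.1 hlu _ hr0').and
      (ENNReal.tendsto_nhds_zero.1 hlv _ hr0')).and (ENNReal.tendsto_nhds_zero.1 hlf _ hr0'))
    refine ⟨N, fun n hn m hm t ht => (key n m t ht).trans_lt (lt_of_le_of_lt ?_ hrε)⟩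
    refine mul_le_mul_of_nonneg_left ?_ hC0.le
    have iu := intervalIntegral_norm_sub_sq_le (hcu n) (hcu m)
      (memLp_indicator_Ioo hu).aestronglyMeasurable hab.le hr0.le (hN n hn).1.1 (hN m hm).1.1
    have iv := intervalIntegral_norm_sub_sq_le (hcv n) (hcv m)
      (memLp_indicator_Ioo hut).aestronglyMeasurable hab.le hr0.le (hN n hn).1.2 (hN m hm).1.2
    have jf := intervalIntegral_norm_sub_sq_le (hcf n) (hcf m)
      (memLp_indicator_Ioo hf).aestronglyMeasurable hab.le hr0.le (hN n hn).2 (hN m hm).2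
    rw [intervalIntegral.integral_add, intervalIntegral.integral_add]
    · linarith
    · exact ((((hcu n).sub (hcu m)).norm).pow 2).intervalIntegrable _ _
    · exact ((((hcv n).sub (hcv m)).norm).pow 2).intervalIntegrable _ _
    · exact ((((hcu n).sub (hcu m)).norm.pow 2).add
        (((hcv n).sub (hcv m)).norm.pow 2)).intervalIntegrable _ _
    · exact ((((hcf n).sub (hcf m)).norm).pow 2).intervalIntegrable _ _
  have hUc : UniformCauchySeqOn (fun n => mollify T (ρ n) u) atTop (Icc a b) := by
    refine Metric.uniformCauchySeqOn_iff.2 fun ε hε => (hcau ε hε).imp fun N hN n hn m hm t ht => ?_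
    rw [dist_eq_norm]
    refine lt_of_pow_lt_pow_left₀ 2 hε.le ?_
    linarith [hN n hn m hm t ht, sq_nonneg ‖mollify T (ρ n) ut t - mollify T (ρ m) ut t‖]
  have hVc : UniformCauchySeqOn (fun n => mollify T (ρ n) ut) atTop (Icc a b) := by
    refine Metric.uniformCauchySeqOn_iff.2 fun ε hε => (hcau ε hε).imp fun N hN n hn m hm t ht => ?_
    rw [dist_eq_norm]
    refine lt_of_pow_lt_pow_left₀ 2 hε.le ?_
    linarith [hN n hn m hm t ht, sq_nonneg ‖mollify T (ρ n) u t - mollify T (ρ m) u t‖]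
  obtain ⟨uc, huc, hue⟩ := exists_continuousOn_of_uniformCauchySeqOn hcu
    (memLp_indicator_Ioo hu).aestronglyMeasurable hUc hlu
  obtain ⟨vc, hvc, hve⟩ := exists_continuousOn_of_uniformCauchySeqOn hcv
    (memLp_indicator_Ioo hut).aestronglyMeasurable hVc hlv
  refine ⟨uc, vc, huc, hvc, ?_, ?_⟩
  · filter_upwards [ae_restrict_mem measurableSet_Ioo, ae_restrict_of_ae hue] with t ht h hm
    rw [← h hm, indicator_of_mem ht]
  · filter_upwards [ae_restrict_mem measurableSet_Ioo, ae_restrict_of_ae hve] with t ht h hm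
    rw [← h hm, indicator_of_mem ht]

/-- Two continuous representatives agree almost everywhere, hence everywhere, on the overlap `[T/3,
2T/3]`; they are joined at its midpoint. -/
theorem exists_continuousOn_glue {X : Type*} [TopologicalSpace X] [T2Space X] (hT : 0 < T)
    {k g₁ g₂ : ℝ → X} (h₁ : ContinuousOn g₁ (Icc 0 (2 * T / 3)))
    (h₂ : ContinuousOn g₂ (Icc (T / 3) T))
    (e₁ : ∀ᵐ t ∂timeMeasure T, t ∈ Icc 0 (2 * T / 3) → k t = g₁ t)
    (e₂ : ∀ᵐ t ∂timeMeasure T, t ∈ Icc (T / 3) T → k t = g₂ t) :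
    ∃ g : ℝ → X, ContinuousOn g (Icc 0 T) ∧ k =ᵐ[timeMeasure T] g := by
  have hsub : Icc (T / 3) (2 * T / 3) ⊆ Ioo 0 T :=
    Icc_subset_Ioo (by linarith) (by linarith)
  have hae : g₁ =ᵐ[volume.restrict (Icc (T / 3) (2 * T / 3))] g₂ := by
    filter_upwards [ae_restrict_mem measurableSet_Icc, ae_restrict_of_ae_restrict_of_subset hsub e₁,
      ae_restrict_of_ae_restrict_of_subset hsub e₂] with t ht p q
    rw [← p ⟨by linarith [ht.1], ht.2⟩, q ⟨ht.1, by linarith [ht.2]⟩]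
  have heq : EqOn g₁ g₂ (Icc (T / 3) (2 * T / 3)) :=
    Measure.eqOn_Icc_of_ae_eq volume (by linarith) hae
      (h₁.mono (Icc_subset_Icc_left (by linarith))) (h₂.mono (Icc_subset_Icc_right (by linarith)))
  let g : ℝ → X := fun t => if t ≤ T / 2 then g₁ t else g₂ t
  have hg₁ : EqOn g g₁ (Icc 0 (T / 2)) := fun t ht => if_pos ht.2
  have hg₂ : EqOn g g₂ (Icc (T / 2) T) := fun t ht => by
    rcases ht.1.eq_or_lt with rfl | hlt
    · exact (if_pos le_rfl).trans (heq ⟨by linarith, by linarith⟩)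
    · exact if_neg (not_le.2 hlt)
  refine ⟨g, ?_, ?_⟩
  · rw [← Icc_union_Icc_eq_Icc (b := T / 2) (by linarith) (by linarith)]
    exact ((h₁.mono (Icc_subset_Icc_right (by linarith))).congr hg₁).union_of_isClosed
      ((h₂.mono (Icc_subset_Icc_left (by linarith))).congr hg₂) isClosed_Icc isClosed_Icc
  · filter_upwards [ae_restrict_mem measurableSet_Ioo, e₁, e₂] with t ht p q
    rcases le_total t (T / 2) with hle | hle
    · rw [hg₁ ⟨ht.1.le, hle⟩, p ⟨ht.1.le, by linarith⟩]
    · rw [hg₂ ⟨hle, ht.2.le⟩, q ⟨by linarith, ht.2.le⟩]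

/-- Weak solutions of `ü + u = f` in `V'` with `f ∈ L²(0, T; H)` are continuous in the energy
norm. -/
theorem exists_continuousOn_energy (hT : 0 < T) (hu : MemLp u 2 (timeMeasure T))
    (hut : MemLp ut 2 (timeMeasure T)) (hf : MemLp f 2 (timeMeasure T))
    (h₁ : ∀ x, HasWeakDerivOn 0 T (fun t => ⟪ι (u t), x⟫) (fun t => ⟪ut t, x⟫))
    (h₂ : ∀ w, HasWeakDerivOn 0 T (fun t => ⟪ut t, ι w⟫) (fun t => ⟪f t, ι w⟫ - ⟪u t, w⟫)) :
    ∃ (uc : ℝ → V) (vc : ℝ → H), ContinuousOn uc (Icc 0 T) ∧ ContinuousOn vc (Icc 0 T) ∧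
      u =ᵐ[timeMeasure T] uc ∧ ut =ᵐ[timeMeasure T] vc := by
  -- Both intervals are shorter than `T`, as the kernels require: here the supports lie in `(-T/3,
  -- 0)`, for the second interval in `(0, T/3)`.
  obtain ⟨u₁, v₁, hu₁, hv₁, eu₁, ev₁⟩ := exists_continuousOn_subinterval (a := 0) (b := 2 * T / 3)
    (by linarith) le_rfl (by linarith) (by linarith) hu hut hf h₁ h₂
  obtain ⟨u₂, v₂, hu₂, hv₂, eu₂, ev₂⟩ := exists_continuousOn_subinterval (a := T / 3) (b := T)
    (by linarith) (by linarith) le_rfl (by linarith) hu hut hf h₁ h₂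
  obtain ⟨uc, huc, hue⟩ := exists_continuousOn_glue hT hu₁ hu₂ eu₁ eu₂
  obtain ⟨vc, hvc, hve⟩ := exists_continuousOn_glue hT hv₁ hv₂ ev₁ ev₂
  exact ⟨uc, vc, huc, hvc, hue, hve⟩

end Regularity

end Abstract

/-! ### The controller terms as a forcing term in `H` -/

theorem HasWeakDerivOn.congr {T : ℝ} {p p' q q' : ℝ → ℝ} (h : HasWeakDerivOn 0 T p q)
    (hp : p =ᵐ[timeMeasure T] p') (hq : q =ᵐ[timeMeasure T] q') : HasWeakDerivOn 0 T p' q' := by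
  intro φ hφ
  have e1 : ∫ x in Ioo 0 T, p' x * deriv φ x = ∫ x in Ioo 0 T, p x * deriv φ x := by
    refine integral_congr_ae ?_
    filter_upwards [hp] with x hx
    rw [hx]
  have e2 : ∫ x in Ioo 0 T, q' x * φ x = ∫ x in Ioo 0 T, q x * φ x := by
    refine integral_congr_ae ?_
    filter_upwards [hq] with x hx
    rw [hx]
  rw [e1, e2, h φ hφ]

theorem weighted_zero_left {L : ℝ} (ρ : ℝ → ℝ) (g : L2 L) : weighted ρ 0 g = 0 := by
  simpa using weighted_smul ρ 0 0 g

namespace Beam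

variable (B : Beam)

/-- The vector of `H` which represents the functional `φ ↦ ¹φ`. -/
noncomputable def slopeVec : B.H := (B.J⁻¹, 0, 0)

/-- The vector of `H` which represents the functional `φ ↦ ²φ`. -/
noncomputable def tipVec : B.H := (0, B.M⁻¹, 0)

theorem inner_slopeVec (φ : B.H) : ⟪B.slopeVec, φ⟫ = φ.slope := by
  rw [inner_H_eq]
  change B.J * (B.J⁻¹ * φ.slope) + B.M * (0 * φ.tip) + weighted B.μ 0 φ.field = _
  rw [weighted_zero_left, mul_inv_cancel_left₀ B.J_pos.ne']
  ring

theorem inner_tipVec (φ : B.H) : ⟪B.tipVec, φ⟫ = φ.tip := by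
  rw [inner_H_eq]
  change B.J * (0 * φ.slope) + B.M * (B.M⁻¹ * φ.tip) + weighted B.μ 0 φ.field = _
  rw [weighted_zero_left, mul_inv_cancel_left₀ B.M_pos.ne']
  ring

variable {B}

theorem memLp_slope {ν : Measure ℝ} {v : ℝ → B.H} (hv : MemLp v 2 ν) :
    MemLp (fun t => (v t).slope) 2 ν := by
  simpa only [Function.comp_def, innerSL_apply_apply, inner_slopeVec] using (innerSL ℝ B.slopeVec).comp_memLp' hv

theorem memLp_tip {ν : Measure ℝ} {v : ℝ → B.H} (hv : MemLp v 2 ν) :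
    MemLp (fun t => (v t).tip) 2 ν := by
  simpa only [Function.comp_def, innerSL_apply_apply, inner_tipVec] using (innerSL ℝ B.tipVec).comp_memLp' hv

end Beam

theorem memLp_dotProduct {n : ℕ} {ν : Measure ℝ} {ζ : ℝ → Fin n → ℝ} (hζ : MemLp ζ 2 ν)
    (c : Fin n → ℝ) : MemLp (fun t => c ⬝ᵥ ζ t) 2 ν := by
  let ℓ : (Fin n → ℝ) →ₗ[ℝ] ℝ :=
    { toFun := fun x => c ⬝ᵥ x
      map_add' := dotProduct_add c
      map_smul' := fun r x => dotProduct_smul r c x }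
  exact (LinearMap.toContinuousLinearMap ℓ).comp_memLp' hζ

end PiezoBeam

/-- Saying that `vc` is itself a weak time derivative of `u` expresses that the continuous function
`vc` represents `u_t`. -/
theorem mainTheorem7 (B : PiezoBeam.Beam) {n : ℕ} (K₁ K₂ : PiezoBeam.Controller n)
    (T : ℝ) (hT : 0 < T) (u₀ : B.V) (v₀ : B.H) (ζ₁₀ ζ₂₀ : Fin n → ℝ)
    (u : ℝ → B.V) (ζ₁ ζ₂ : ℝ → Fin n → ℝ)
    (hu : PiezoBeam.IsWeakSolution T K₁ K₂ u₀ v₀ ζ₁₀ ζ₂₀ u ζ₁ ζ₂) :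
    ∃ (uc : ℝ → B.V) (vc : ℝ → B.H),
      u =ᵐ[PiezoBeam.timeMeasure T] uc ∧
      PiezoBeam.HasWeakTimeDerivH T (fun t => (u t).toH) vc ∧
      ContinuousOn uc (Icc 0 T) ∧
      ContinuousOn vc (Icc 0 T) := by
  obtain ⟨ut, utt, hu2, hut2, -, hd, hdd, heq, ⟨-, hζ₁, -⟩, ⟨-, hζ₂, -⟩, -⟩ := hu
  have huH : MemLp (fun t => (u t).toH) 2 (PiezoBeam.timeMeasure T) :=
    B.inclusion.comp_memLp' hu2
  -- All terms except `(u, ·)_V` are moved to the right-hand side and represented in `H` by the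
  -- Riesz vectors of slope and tip; the coefficients are square integrable in time.
  let f : ℝ → B.H := fun t =>
    (-(K₁.k * (u t).toH.slope + K₁.d * (ut t).slope + K₁.c ⬝ᵥ ζ₁ t)) • B.slopeVec
      + (-(K₂.k * (u t).toH.tip + K₂.d * (ut t).tip + K₂.c ⬝ᵥ ζ₂ t)) • B.tipVec
  have hmul : ∀ {p : ℝ → ℝ} (e : B.H), MemLp p 2 (PiezoBeam.timeMeasure T) →
      MemLp (fun t => p t • e) 2 (PiezoBeam.timeMeasure T) := fun e hp =>
    ((ContinuousLinearMap.id ℝ ℝ).smulRight e).comp_memLp' hp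
  have hf : MemLp f 2 (PiezoBeam.timeMeasure T) := by
    refine (hmul _ (MemLp.neg ?_)).add (hmul _ (MemLp.neg ?_))
    · exact (((PiezoBeam.Beam.memLp_slope huH).const_mul _).add
        ((PiezoBeam.Beam.memLp_slope hut2).const_mul _)).add (PiezoBeam.memLp_dotProduct hζ₁ _)
    · exact (((PiezoBeam.Beam.memLp_tip huH).const_mul _).add
        ((PiezoBeam.Beam.memLp_tip hut2).const_mul _)).add (PiezoBeam.memLp_dotProduct hζ₂ _)
  obtain ⟨uc, vc, huc, hvc, hue, hve⟩ := PiezoBeam.exists_continuousOn_energy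
    (ι := B.inclusion) hT hu2 hut2 hf hd (fun w => by
      refine (hdd w).congr (Filter.EventuallyEq.refl _ _) ?_
      filter_upwards [heq] with t ht
      have h := ht w
      simp only [PiezoBeam.formA, PiezoBeam.formB, PiezoBeam.formE₁, PiezoBeam.formE₂] at h
      simp only [f, inner_add_left, real_inner_smul_left, PiezoBeam.Beam.inner_slopeVec,
        PiezoBeam.Beam.inner_tipVec, PiezoBeam.Beam.inclusion_apply]
      linarith)
  refine ⟨uc, vc, hue, fun x => ?_, huc, hvc⟩
  refine (hd x).congr (Filter.EventuallyEq.refl _ _) ?_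
  filter_upwards [hve] with t ht
  rw [ht]
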